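/- **Setting.** There are $n\ge 2$ processors $p_1,\dots,p_n$, with $n\ge 4f+1$, of which at most $f$ are faulty (Byzantine: they may behave arbitrarily); the others are *correct*. Time is divided into timeslots $0,1,2,\dots$ A message sent at $s$ arrives at some $s'$ with $s<s'\le\max\{\mathrm{GST},s\}+\Delta$, where $\Delta\ge1$ is known and GST is not; $\delta\ge 1$ is the least number (the statement holds for any number) such that always $s'\le\max\{\mathrm{GST},s\}+\delta$. Messages to oneself are received at once. Correct processors begin no later than GST, in view $1$. Signatures and threshold signatures are unforgeable, and the hash function $H$ is injective. "Disseminate" means "send to all processors". *Views and leaders.* For some $x\ge 2$, superview $w\ge1$ consists of the views $(w-1)x+1,\dots,wx$; a view $v\equiv1\pmod x$ is *initial*. All views of superview $w$ have the leader $p_{j+1}$, where $0\le j<n$ and $j\equiv w\pmod n$. *Blocks.* For each $k\in[1,n]$ an $(n,k)$-erasure code encodes a bit string $C$ as fragments $c_1,\dots,c_n$, any $k$ of which, with $|C|$, determine $C$. The tag of $(C,k)$ is $\tau(C,k)=(|C|,k,r)$, where $r$ is the root of the Merkle tree of $c_1,\dots,c_n$. A view $v$ block is a tuple $b=(v,(\beta,k,r),h)$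 with $v\ge1$ and $n-f-1\le k\le n-1$, signed by $\mathrm{lead}(v)$, where $h$ is the hash of the parent block; the genesis block, of view $0$, has no parent. A *certified fragment of $b$ at $i$* is $(b,i,c,\pi)$ with $c$ of the right length and $\pi$ a validation path from $r$ to $c$ at position $i$. Decoding from $k$ fragments reconstructs a string and fails unless its tag is that of $b$. *Certificates.* A stage-1 notarisation for $b$ consists of stage-1 votes for $b$ by at least $n-\frac32f$ processors. Stage-2 votes for $b$ by $f+1$ processors form an M-certificate for $b$, and by $n-f$ processors a *stage-2 certificate* for $b$; nullify$(v)$ messages by $2f+1$ processors form an N-certificate for $v$. A processor *receives* a certificate if it receives it as a message or receives messages that form it. *Local data of a correct processor $p_i$.* $\mathtt{blocks}$ contains the genesis block and every block for which $p_i$ has an M-certificate and whose parent is in $\mathtt{blocks}$. $\mathtt{blocks}^*$ contains the genesis block and every block $b$ with parent in $\mathtt{blocks}$ for which $p_i$ has received a stage-1 notarisation and, for some $k$ indices $j$, from $p_j$ a certified fragment of $b$ at $j$, such that decoding from these succeeds ($k$ being the parameter of $b$). A received certified fragment $(b,i,c,\pi)$ of a view $v$ block is *votable for view $v$* if the parent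 $b'$ of $b$ is in $\mathtt{blocks}$, $b'$ has view $<v$, and $p_i$ has N-certificates for all views strictly between that of $b'$ and $v$. The variable $\mathtt b$ is initially the genesis block; the timer $\mathtt T$ is $0$ initially and on entering a view, and otherwise runs in real time. *Protocol (Carnot 1).* At each timeslot, in its present view $\mathtt v$, a correct $p_i$ executes the following instructions in order, repeatedly until none has any further effect. 1. Disseminate all new certificates (of the three kinds). 2. If $p_i=\mathrm{lead}(\mathtt v)$ and ProposeReady holds: propose a block, i.e. choose a payload $C$ and a reconstruction parameter $k\in[n-f-1,n-1]$, with $k=n-f-1$ if the block is for an initial view, and send each $p_j$ its certified fragment at $j$. If $\mathtt v$ is initial and $p_i$ has not yet proposed in this superview, then ProposeReady holds, and the block is for view $\mathtt v$ with parent $\mathtt b$. Otherwise the block is for the view following the greatest view of the superview for which $p_i$ has proposed, with that proposal as parent; in this case ProposeReady is a free choice (false if all views of the superview have been used), subject only to: whenever a correct processor enters a non-initial view $u+1$ at time $s$ upon adding a view $u$ block to $\mathtt{blocks}$, and $\mathrm{lead}(u)$ is correct, then $\mathrm{lead}(u)$ proposes a block for view $u+1$ at some time $s'<s$. 3. If $p_i$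 has a votable fragment $(b,i,c,\pi)$ for view $\mathtt v$ and has not stage-1 voted in view $\mathtt v$: disseminate a stage-1 vote for $b$ and, if $p_i\ne\mathrm{lead}(\mathtt v)$, the fragment. 4. If $\mathtt{blocks}^*$ contains a view $\mathtt v$ block $b$, and $p_i$ has neither stage-2 voted in view $\mathtt v$ nor sent nullify$(\mathtt v)$: disseminate a stage-2 vote for $b$. 5. If $\mathtt{blocks}$ contains a view $\mathtt v$ block $b$: disseminate a stage-2 vote for $b$ under the same proviso; set $\mathtt b:=b$ and enter view $\mathtt v+1$. 6. If nullify$(\mathtt v)$ has not been sent and the time-out condition holds: disseminate nullify$(u)$ for all $u\ge\mathtt v$ in the superview of $\mathtt v$. The condition is that no stage-2 vote has been sent in view $\mathtt v$ and either $\mathtt T=m\Delta$ and no stage-1 vote has been sent in view $\mathtt v$, or $\mathtt T=(m+1)\Delta$; here $m=2$ if $\mathtt v$ is initial and $m=1$ otherwise. 7. If $p_i$ has an N-certificate for $\mathtt v$: enter view $\mathtt v+1$. *Well-disseminated fragments.* Let $\mathrm{lead}(u)$ be correct and propose a view $u$ block $b$ with reconstruction parameter $k$. Fragments are *well disseminated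 in view $u$* if at least $k$ processors $p_j$ (correct or faulty) disseminate a certified fragment of $b$ at $j$ upon receiving a votable fragment for view $u$, i.e. no later than the first time at which the messages received by $p_j$ make a fragment of $b$ at $j$ votable and contain what is needed to leave all views before $u$. **Lemma (Correct leaders finalise many blocks).** Suppose view $v$ is not initial, $\mathrm{lead}(v)$ is correct, and let $v_0$ be the first view in the same superview as $v$. Suppose the first correct processor to enter view $v_0$ does so at or after GST, and the first correct processor to enter view $v$ does so at $t$. Suppose further that fragments are well disseminated in all views in the interval $(v_0,v]$. Then there is a view $v$ block for which all correct processors receive a stage-2 certificate by $t+3\delta$, and all correct processors enter view $v+1$ by this time. Furthermore, no correct processor sends a nullify$(v)$ message. -/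

import Mathlib

/-!
A model of the state-machine-replication protocol Carnot 1 (without optimistic proposals) in the
partial synchrony model: hashes, Merkle trees, erasure codes, blocks, messages, the local
instructions of a correct processor, and executions with Byzantine processors.
-/

namespace Carnot

universe u

/-! ### Erasure codes, hashes and Merkle trees -/

/-- Bit strings. -/
abbrev Bits := List Bool

/-- A family of `(n,k)`-erasure codes, one for each `k ∈ [1,n]`: a bit string `C` is encoded as
`n` fragments, whose common length depends only on `n`, `k` and the length of `C`, and `C` can be
reconstructed from its length and any `k` of the (indexed) fragments. On ill-formed input
`reconstruct` is arbitrary; `none` stands for failure. -/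
structure ErasureCode (n : ℕ) where
  enc : ℕ → Bits → Fin n → Bits
  fragLen : ℕ → ℕ → ℕ
  reconstruct : ℕ → ℕ → Finset (Fin n × Bits) → Option Bits
  enc_length : ∀ k C i, 1 ≤ k → k ≤ n → (enc k C i).length = fragLen k C.length
  reconstruct_enc : ∀ k C (I : Finset (Fin n)), 1 ≤ k → k ≤ n → I.card = k →
    reconstruct k C.length (I.image fun i => (i, enc k C i)) = some C

/-- A tag `(β, k, r)`: message length, reconstruction parameter, Merkle root. -/
structure Tag (Hash : Type u) where
  len : ℕ
  k : ℕ
  root : Hash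

/-- A block `(v, tag, h)`, where `h` is the hash of the parent (`none` is the empty sequence, used
by the genesis block only). A value of this type stands for the tuple together with the (unique)
signature of the leader of its view; see `Run.Backed` for unforgeability. -/
structure Block (Hash : Type u) where
  view : ℕ
  tag : Tag Hash
  par : Option Hash

/-- The values to which the hash function is applied: fragments, pairs of hashes, blocks. -/
inductive Preimage (Hash : Type u) where
  | leaf (c : Bits)
  | node (l r : Hash)
  | block (b : Block Hash)

/-- Shapes of full binary trees. -/
inductive FullTree where
  | leaf
  | node (l r : FullTree)

/-- The number of leaves. -/
def FullTree.size : FullTree → ℕ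
  | .leaf => 1
  | .node l r => l.size + r.size

section Merkle

variable {Hash : Type u} (H : Preimage Hash → Hash)

/-- The root of the Merkle tree with leaves the hashes of `c 0, c 1, …`. -/
def merkleRoot : FullTree → (ℕ → Bits) → Hash
  | .leaf, c => H (.leaf (c 0))
  | .node l r, c => H (.node (merkleRoot l c) (merkleRoot r fun j => c (j + l.size)))

/-- The siblings of the nodes on the way from the root down to position `i`. -/
def merklePath : FullTree → (ℕ → Bits) → ℕ → List Hash
  | .leaf, _, _ => []
  | .node l r, c, i =>
      if i < l.size then (merkleRoot H r fun j => c (j + l.size)) :: merklePath l c i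
      else merkleRoot H l c :: merklePath r (fun j => c (j + l.size)) (i - l.size)

/-- The root recomputed from a claimed value `c` at position `i` and a list of siblings (`none`
if the list does not have the right length). -/
def recomputeRoot : FullTree → ℕ → Bits → List Hash → Option Hash
  | .leaf, _, c, [] => some (H (.leaf c))
  | .leaf, _, _, _ :: _ => none
  | .node _ _, _, _, [] => none
  | .node l r, i, c, h :: π =>
      if i < l.size then (recomputeRoot l i c π).map fun y => H (.node y h)
      else (recomputeRoot r (i - l.size) c π).map fun y => H (.node h y)

end Merkle

/-- The parameters of the protocol: `n` processors, at most `f` of them faulty, superviews of `x`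
views, the known delay bound `Δ`, the hash function, the shape of the Merkle trees, the codes. -/
structure Params (Hash : Type u) where
  n : ℕ
  f : ℕ
  x : ℕ
  Δ : ℕ
  H : Preimage Hash → Hash
  tree : FullTree
  code : ErasureCode n

/-- Protocol messages. Indices `i : Fin n` name the signer of a vote or nullify message. Only
messages whose signatures are valid are represented, certificates are unique for what they
certify, and the signature shares of stage-2 votes and nullify messages are part of those
messages. -/
inductive Msg (Hash : Type u) (n : ℕ) where
  | frag (b : Block Hash) (j : Fin n) (c : Bits) (π : List Hash)
  | vote1 (b : Block Hash) (i : Fin n)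
  | vote2 (b : Block Hash) (i : Fin n)
  | mcert (b : Block Hash)
  | cert (b : Block Hash)
  | nullify (v : ℕ) (i : Fin n)
  | ncert (v : ℕ)

/-- Sets of messages, each paired with a processor (the sender for received messages, the
recipient for sent ones). -/
abbrev Mail (Hash : Type u) (n : ℕ) := Set (Fin n × Msg Hash n)

namespace Params

variable {Hash : Type u} (P : Params Hash)

/-! ### Encoding and decoding -/

/-- The fragments of `C`, listed from position `0` (and padded by empty strings after `n`). -/
def frags (C : Bits) (k : ℕ) (i : ℕ) : Bits :=
  if h : i < P.n then P.code.enc k C ⟨i, h⟩ else []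

/-- `τ(C,k)`. -/
def tag (C : Bits) (k : ℕ) : Tag Hash :=
  ⟨C.length, k, merkleRoot P.H P.tree (P.frags C k)⟩

/-- `(c, π)` is a certified fragment of the tag `z` at `i`. -/
def CertFrag (z : Tag Hash) (i : Fin P.n) (c : Bits) (π : List Hash) : Prop :=
  c.length = P.code.fragLen z.k z.len ∧ recomputeRoot P.H P.tree i c π = some z.root

open Classical in
/-- Decode: reconstruct a message, recompute its tag and compare; `none` is `⊥`. -/
noncomputable def decode (z : Tag Hash) (F : Finset (Fin P.n × Bits)) : Option Bits :=
  (P.code.reconstruct z.k z.len F).bind fun C => if P.tag C z.k = z then some C else none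

/-! ### Superviews, leaders, blocks -/

/-- The superview to which a view `v ≥ 1` belongs. -/
def superview (v : ℕ) : ℕ := (v - 1) / P.x + 1

/-- The first view in the superview of `v`. -/
def firstView (v : ℕ) : ℕ := (v - 1) / P.x * P.x + 1

/-- Initial views: `v ≡ 1 mod x`. -/
def Initial (v : ℕ) : Prop := v ≡ 1 [MOD P.x]

/-- `p = lead(v)`. Processor `p_{j+1}` has index `j`. -/
def IsLead (p : Fin P.n) (v : ℕ) : Prop := (p : ℕ) = P.superview v % P.n

/-- The genesis block. -/
def genesis : Block Hash := ⟨0, P.tag [] P.n, none⟩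

/-- `H(b') = b.par`. -/
def IsParent (b' b : Block Hash) : Prop := b.par = some (P.H (.block b'))

/-- Format of blocks other than the genesis block: a view at least `1`, a reconstruction
parameter in `[n-f-1, n-1]`, a parent hash. -/
def IsBlock (b : Block Hash) : Prop :=
  1 ≤ b.view ∧ P.n ≤ b.tag.k + P.f + 1 ∧ b.tag.k + 1 ≤ P.n ∧ b.par.isSome

/-! ### The automatically updated local variables, as functions of the received messages -/

variable (S : Mail Hash P.n)

/-- `certificates`: received certificates, and those formed from received stage-2
(M-)notarisations and nullifications. -/
inductive Certs : Msg Hash P.n → Prop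
  | mcert (q : Fin P.n) (b : Block Hash) : (q, .mcert b) ∈ S → Certs (.mcert b)
  | cert (q : Fin P.n) (b : Block Hash) : (q, .cert b) ∈ S → Certs (.cert b)
  | ncert (q : Fin P.n) (v : ℕ) : (q, .ncert v) ∈ S → Certs (.ncert v)
  | formM (b : Block Hash) :
      P.f + 1 ≤ {i | ∃ q, (q, Msg.vote2 b i) ∈ S}.ncard → Certs (.mcert b)
  | form (b : Block Hash) :
      P.n - P.f ≤ {i | ∃ q, (q, Msg.vote2 b i) ∈ S}.ncard → Certs (.cert b)
  | formN (v : ℕ) :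
      2 * P.f + 1 ≤ {i | ∃ q, (q, Msg.nullify v i) ∈ S}.ncard → Certs (.ncert v)

/-- `blocks`. -/
inductive Blocks : Block Hash → Prop
  | gen : Blocks P.genesis
  | step (b b' : Block Hash) : P.IsBlock b → P.Certs S (.mcert b) → Blocks b' →
      P.IsParent b' b → Blocks b

/-- A stage-1 notarisation for `b` has been received: at least `n - (3/2) f` stage-1 votes. -/
def Notarised1 (b : Block Hash) : Prop :=
  2 * P.n ≤ 2 * {i | ∃ q, (q, Msg.vote1 b i) ∈ S}.ncard + 3 * P.f

/-- `blocks*`. Fragments count only if received from the processor to which they belong. -/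
def BlocksStar (b : Block Hash) : Prop :=
  b = P.genesis ∨
    (P.IsBlock b ∧ P.Notarised1 S b ∧
      (∃ (I : Finset (Fin P.n)) (c : Fin P.n → Bits) (π : Fin P.n → List Hash),
        I.card = b.tag.k ∧
        (∀ j ∈ I, (j, .frag b j (c j) (π j)) ∈ S ∧ P.CertFrag b.tag j (c j) (π j)) ∧
        P.decode b.tag (I.image fun j => (j, c j)) ≠ none) ∧
      ∃ b', P.Blocks S b' ∧ P.IsParent b' b)

/-- Given the received messages `S`, processor `i` has received the fragment `(b, i, c, π)` and
this fragment is votable for view `v`. -/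
def Votable (i : Fin P.n) (v : ℕ) (b : Block Hash) (c : Bits) (π : List Hash) : Prop :=
  (∃ q, (q, .frag b i c π) ∈ S) ∧ P.IsBlock b ∧ b.view = v ∧ P.CertFrag b.tag i c π ∧
    ∃ b', P.Blocks S b' ∧ P.IsParent b' b ∧ b'.view < v ∧
      ∀ u, b'.view < u → u < v → P.Certs S (.ncert u)

/-- The received messages `S` allow all views before `v` to be left. -/
def Reached (v : ℕ) : Prop :=
  ∀ u, 1 ≤ u → u < v → P.Certs S (.ncert u) ∨ ∃ b, P.Blocks S b ∧ b.view = u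

end Params

/-! ### The instructions of a correct processor -/

/-- Local state of a correct processor. `par` is the variable `b` of the protocol, `T` the timer,
`nullified`, `voted1`, `voted2` are the sets of views for which the respective flag is true,
`proposed` is the set of blocks proposed so far, `out` the set of (recipient, message) pairs sent
in the current timeslot. `viaBlock` is a record, not used by the protocol, of the views which were
entered upon adding a block for the preceding view to `blocks`. -/
structure LState (Hash : Type u) (n : ℕ) where
  view : ℕ
  par : Block Hash
  T : ℕ
  nullified : Set ℕ
  voted1 : Set ℕ
  voted2 : Set ℕ
  proposed : Set (Block Hash)
  viaBlock : Set ℕ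
  out : Mail Hash n

/-- What is fixed during one timeslot of processor `p`: the messages received before any
instruction of this timeslot is executed, the certificates held at earlier timeslots, and the
flexible part (Case 2) of the predicate `ProposeReady`. -/
structure Ctx (Hash : Type u) (n : ℕ) where
  p : Fin n
  inbox : Mail Hash n
  known : Set (Msg Hash n)
  ready : LState Hash n → Prop

/-- The set of pairs by which `m` is disseminated, i.e. sent to all processors. -/
def toAll {Hash : Type u} {n : ℕ} (m : Msg Hash n) : Mail Hash n := {y | y.2 = m}

/-- Send the messages in `A`. -/
def LState.send {Hash : Type u} {n : ℕ} (s : LState Hash n) (A : Mail Hash n) : LState Hash n :=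
  { s with out := s.out ∪ A }

/-- All messages received so far; messages to oneself are received immediately (a message with
recipient `p` in `out` is a message with sender `p`). -/
def Ctx.S {Hash : Type u} {n : ℕ} (K : Ctx Hash n) (s : LState Hash n) : Mail Hash n :=
  K.inbox ∪ {y | y ∈ s.out ∧ y.1 = K.p}

namespace Params

variable {Hash : Type u} (P : Params Hash)

/-- The state in which a processor begins (in view `1`). -/
def init : LState Hash P.n := ⟨1, P.genesis, 0, ∅, ∅, ∅, ∅, ∅, ∅⟩

/-- Passage to the next timeslot. -/
def tick (s : LState Hash P.n) : LState Hash P.n := { s with T := s.T + 1, out := ∅ }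

variable (K : Ctx Hash P.n) (s s' : LState Hash P.n)

/-- Disseminate new N-certificates, stage-2 certificates and stage-2 M-certificates. -/
def CertLine : Prop :=
  s' = s.send {y | P.Certs (K.S s) y.2 ∧ y.2 ∉ K.known}

/-- The leader is in an initial view and has proposed no block for this superview. -/
def FreshSuperview : Prop :=
  P.Initial s.view ∧ ∀ b ∈ s.proposed, P.superview b.view ≠ P.superview s.view

/-- `p = lead(v)`, `ProposeReady` is true, and `ProposeBlock` is to propose a block for view `v`
with parent `b`. In Case 2 the parent is the last block proposed for the superview, provided that
there is one and that it is not for the last view of the superview. -/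
def ProposeTarget (v : ℕ) (b : Block Hash) : Prop :=
  P.IsLead K.p s.view ∧
    ((P.FreshSuperview s ∧ v = s.view ∧ b = s.par) ∨
     (¬ P.FreshSuperview s ∧ K.ready s ∧ b ∈ s.proposed ∧
      P.superview b.view = P.superview s.view ∧
      (∀ b' ∈ s.proposed, P.superview b'.view = P.superview s.view → b'.view ≤ b.view) ∧
      v = b.view + 1 ∧ P.superview v = P.superview s.view))

/-- Propose a block `(v, τ(C,k), H(b))` and send each processor its fragment. The payload `C` may
be any bit string, and `k` any value in `[n-f-1, n-1]` which equals `n-f-1` if `v` is initial. -/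
def ProposeLine : Prop :=
  (∃ (v : ℕ) (b : Block Hash) (C : Bits) (k : ℕ), P.ProposeTarget K s v b ∧
    P.n ≤ k + P.f + 1 ∧ k + 1 ≤ P.n ∧ (P.Initial v → P.n = k + P.f + 1) ∧
    s' = { s with
      proposed := insert ⟨v, P.tag C k, some (P.H (.block b))⟩ s.proposed
      out := s.out ∪ Set.range fun j : Fin P.n =>
        (j, .frag ⟨v, P.tag C k, some (P.H (.block b))⟩ j (P.code.enc k C j)
          (merklePath P.H P.tree (P.frags C k) j)) }) ∨
  ((¬ ∃ v b, P.ProposeTarget K s v b) ∧ s' = s)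

/-- Upon holding a votable fragment: stage-1 vote, and disseminate the fragment if not leader. -/
def Vote1Line : Prop :=
  (∃ b c π, P.Votable (K.S s) K.p s.view b c π ∧ s.view ∉ s.voted1 ∧
    s' = { s with
      voted1 := insert s.view s.voted1
      out := s.out ∪ toAll (.vote1 b K.p) ∪
        {y | ¬ P.IsLead K.p s.view ∧ y ∈ toAll (.frag b K.p c π)} }) ∨
  ((¬ ∃ b c π, P.Votable (K.S s) K.p s.view b c π ∧ s.view ∉ s.voted1) ∧ s' = s)

/-- A stage-2 vote in the present view is still allowed. -/
def MayVote2 : Prop := s.view ∉ s.nullified ∧ s.view ∉ s.voted2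

/-- The state after a stage-2 vote for `b`. -/
def vote2 (b : Block Hash) : LState Hash P.n :=
  { s with voted2 := insert s.view s.voted2, out := s.out ∪ toAll (.vote2 b K.p) }

/-- Stage-2 vote upon holding a block of the present view in `blocks*`. -/
def Vote2Line : Prop :=
  (∃ b, P.BlocksStar (K.S s) b ∧ b.view = s.view ∧ P.MayVote2 s ∧ s' = P.vote2 K s b) ∨
  ((¬ ∃ b, P.BlocksStar (K.S s) b ∧ b.view = s.view ∧ P.MayVote2 s) ∧ s' = s)

/-- Set `b := b₀`, go to the next view and reset the timer. -/
def advance (b₀ : Block Hash) : LState Hash P.n :=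
  { s with view := s.view + 1, par := b₀, T := 0, viaBlock := insert (s.view + 1) s.viaBlock }

/-- Upon holding a block of the present view in `blocks`: stage-2 vote if still allowed, and go to
the next view. -/
def BlockLine : Prop :=
  (∃ b, P.Blocks (K.S s) b ∧ b.view = s.view ∧
    ((P.MayVote2 s ∧ s' = P.advance (P.vote2 K s b) b) ∨
     (¬ P.MayVote2 s ∧ s' = P.advance s b))) ∨
  ((¬ ∃ b, P.Blocks (K.S s) b ∧ b.view = s.view) ∧ s' = s)

/-- The predicate `TimeoutReady`. -/
def TimeoutReady : Prop :=
  (¬ P.Initial s.view ∧ s.T = P.Δ ∧ s.view ∉ s.voted1 ∧ s.view ∉ s.voted2) ∨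
  (¬ P.Initial s.view ∧ s.T = 2 * P.Δ ∧ s.view ∉ s.voted2) ∨
  (P.Initial s.view ∧ s.T = 2 * P.Δ ∧ s.view ∉ s.voted1 ∧ s.view ∉ s.voted2) ∨
  (P.Initial s.view ∧ s.T = 3 * P.Δ ∧ s.view ∉ s.voted2)

/-- On a time-out, nullify the present view and all later ones in its superview. -/
def TimeoutLine : Prop :=
  (s.view ∉ s.nullified ∧ P.TimeoutReady s ∧
    s' = { s with
      nullified := s.nullified ∪ {v | s.view ≤ v ∧ P.superview v = P.superview s.view}
      out := s.out ∪ {y | ∃ v, s.view ≤ v ∧ P.superview v = P.superview s.view ∧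
        y ∈ toAll (.nullify v K.p)} }) ∨
  (¬ (s.view ∉ s.nullified ∧ P.TimeoutReady s) ∧ s' = s)

/-- Upon holding an N-certificate for the present view, go to the next view. -/
def NullLine : Prop :=
  (P.Certs (K.S s) (.ncert s.view) ∧ s' = { s with view := s.view + 1, T := 0 }) ∨
  (¬ P.Certs (K.S s) (.ncert s.view) ∧ s' = s)

/-- One pass through the instructions, in the order of the pseudocode. -/
def Pass : Prop :=
  ∃ s₁ s₂ s₃ s₄ s₅ s₆, P.CertLine K s s₁ ∧ P.ProposeLine K s₁ s₂ ∧ P.Vote1Line K s₂ s₃ ∧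
    P.Vote2Line K s₃ s₄ ∧ P.BlockLine K s₄ s₅ ∧ P.TimeoutLine K s₅ s₆ ∧ P.NullLine K s₆ s'

/-- One timeslot: the instructions are executed repeatedly until none of them has any further
effect (so that, for instance, a processor that enters a view acts in this view at once). -/
def Slot : Prop := Relation.ReflTransGen (P.Pass K) s s' ∧ P.Pass K s' s'

end Params

/-! ### Executions -/

/-- The data of an execution: the correct processors, GST, the timeslots at which processors
begin, the local state at the end of each timeslot (of interest for correct processors only), the
(recipient, message) pairs sent by each processor at each timeslot, the time `arr q p s m` at which
the message `m` sent by `q` to `p ≠ q` at `s` arrives, and the flexible part of `ProposeReady`. -/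
structure Run {Hash : Type u} (P : Params Hash) where
  correct : Finset (Fin P.n)
  GST : ℕ
  start : Fin P.n → ℕ
  st : Fin P.n → ℕ → LState Hash P.n
  sent : Fin P.n → ℕ → Mail Hash P.n
  arr : Fin P.n → Fin P.n → ℕ → Msg Hash P.n → ℕ
  ready : Fin P.n → ℕ → LState Hash P.n → Prop

namespace Run

variable {Hash : Type u} {P : Params Hash} (E : Run P)

/-- The (sender, message) pairs received by `p` from other processors at timeslots `≤ t`. -/
def fromOthers (p : Fin P.n) (t : ℕ) : Mail Hash P.n :=
  {y | y.1 ≠ p ∧ ∃ s, (p, y.2) ∈ E.sent y.1 s ∧ E.arr y.1 p s y.2 ≤ t}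

/-- All (sender, message) pairs received by `p` at timeslots `≤ t`. -/
def received (p : Fin P.n) (t : ℕ) : Mail Hash P.n :=
  E.fromOthers p t ∪ {y | y.1 = p ∧ ∃ s ≤ t, y ∈ E.sent p s}

/-- The context in which `p` executes its instructions at timeslot `t`. -/
def ctx (p : Fin P.n) (t : ℕ) : Ctx Hash P.n where
  p := p
  inbox := E.fromOthers p t ∪ {y | y.1 = p ∧ ∃ s < t, y ∈ E.sent p s}
  known := {m | ∃ s < t, P.Certs (E.received p s) m}
  ready := E.ready p t

/-- Correct `p` enters view `v` at timeslot `t`. -/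
def Enters (p : Fin P.n) (v t : ℕ) : Prop :=
  E.start p ≤ t ∧ v ≤ (E.st p t).view ∧ ∀ s, E.start p ≤ s → s < t → (E.st p s).view < v

/-- Correct `p` proposes the block `b` at timeslot `t`. -/
def Proposes (p : Fin P.n) (b : Block Hash) (t : ℕ) : Prop :=
  E.start p ≤ t ∧ b ∈ (E.st p t).proposed ∧
    ∀ s, E.start p ≤ s → s < t → b ∉ (E.st p s).proposed

/-- `p` has sent the message `m` (to somebody) by timeslot `t`. -/
def SentBy (p : Fin P.n) (m : Msg Hash P.n) (t : ℕ) : Prop :=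
  ∃ s ≤ t, ∃ q, (q, m) ∈ E.sent p s

/-- If the leader who signs `b` is correct, then it has proposed `b` by timeslot `t`. -/
def BlockBacked (b : Block Hash) (t : ℕ) : Prop :=
  1 ≤ b.view → ∀ p ∈ E.correct, P.IsLead p b.view → ∃ s ≤ t, E.Proposes p b s

/-- At least `k` processors have produced shares, where share `i` is contained in the message
`m i`: the correct ones among them have sent it by timeslot `t`. -/
def SharesBacked (k : ℕ) (m : Fin P.n → Msg Hash P.n) (t : ℕ) : Prop :=
  ∃ A : Finset (Fin P.n), k ≤ A.card ∧ ∀ i ∈ A, i ∈ E.correct → E.SentBy i (m i) t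

/-- Unforgeability: the signatures and signature shares of correct processors that a message
contains, or that are needed to form a certificate, have been sent out by timeslot `t`. -/
def Backed (t : ℕ) : Msg Hash P.n → Prop
  | .frag b _ _ _ => E.BlockBacked b t
  | .vote1 b i => E.BlockBacked b t ∧ (i ∈ E.correct → E.SentBy i (.vote1 b i) t)
  | .vote2 b i => E.BlockBacked b t ∧ (i ∈ E.correct → E.SentBy i (.vote2 b i) t)
  | .mcert b => E.BlockBacked b t ∧ E.SharesBacked (P.f + 1) (fun i => .vote2 b i) t
  | .cert b => E.BlockBacked b t ∧ E.SharesBacked (P.n - P.f) (fun i => .vote2 b i) t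
  | .nullify v i => i ∈ E.correct → E.SentBy i (.nullify v i) t
  | .ncert v => E.SharesBacked (2 * P.f + 1) (fun i => .nullify v i) t

/-- `E` is an execution of Carnot 1 in the partial synchrony model. -/
structure IsExecution : Prop where
  /-- At most `f` processors are not correct. -/
  faulty_le : E.correctᶜ.card ≤ P.f
  /-- Correct processors begin no later than GST. -/
  start_le : ∀ p ∈ E.correct, E.start p ≤ E.GST
  /-- A message sent at `s` arrives after `s`, and no later than `max {GST, s} + Δ`. -/
  lt_arr : ∀ q p s m, q ≠ p → (p, m) ∈ E.sent q s → s < E.arr q p s m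
  arr_le : ∀ q p s m, q ≠ p → (p, m) ∈ E.sent q s → E.arr q p s m ≤ max E.GST s + P.Δ
  /-- Correct processors receive messages only once they have begun. -/
  start_le_arr : ∀ q, ∀ p ∈ E.correct, ∀ s m, q ≠ p → (p, m) ∈ E.sent q s →
    E.start p ≤ E.arr q p s m
  /-- Correct processors follow the protocol. -/
  sent_before : ∀ p ∈ E.correct, ∀ t < E.start p, E.sent p t = ∅
  sent_eq : ∀ p ∈ E.correct, ∀ t, E.start p ≤ t → E.sent p t = (E.st p t).out
  slot_first : ∀ p ∈ E.correct, P.Slot (E.ctx p (E.start p)) P.init (E.st p (E.start p))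
  slot_next : ∀ p ∈ E.correct, ∀ t, E.start p ≤ t →
    P.Slot (E.ctx p (t + 1)) (P.tick (E.st p t)) (E.st p (t + 1))
  /-- Faulty processors may send anything that does not break the cryptography. -/
  unforgeable : ∀ p ∉ E.correct, ∀ t, ∀ y ∈ E.sent p t, E.Backed t y.2
  /-- The protocol's requirement on `ProposeReady` in Case 2: if a correct processor enters the
  non-initial view `v + 1` at `t` upon adding a view `v` block to `blocks`, then the leader, if
  correct, proposes a block for view `v + 1` at some `t' < t`. -/
  ready_spec : ∀ v, 1 ≤ v → ¬ P.Initial (v + 1) → ∀ p ∈ E.correct, P.IsLead p v →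
    ∀ q ∈ E.correct, ∀ t, E.Enters q (v + 1) t → v + 1 ∈ (E.st q t).viaBlock →
      ∃ t' < t, ∃ b, E.Proposes p b t' ∧ b.view = v + 1

/-- `δ` bounds the message delay after GST. -/
def DelayBound (δ : ℕ) : Prop :=
  ∀ q p s m, q ≠ p → (p, m) ∈ E.sent q s → E.arr q p s m ≤ max E.GST s + δ

/-- Processor `j` (correct or not) disseminates a certified fragment of `b` at `j` upon receiving a
votable fragment: it does so no later than the first timeslot at which its received messages allow
it to be in view `b.view` and make a fragment of `b` at `j` votable for this view. -/
def DisseminatesFragment (j : Fin P.n) (b : Block Hash) : Prop :=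
  ∃ (c : Bits) (π : List Hash) (s : ℕ), P.CertFrag b.tag j c π ∧
    (∀ q, q ≠ j → (q, .frag b j c π) ∈ E.sent j s) ∧
    ∀ t, P.Reached (E.received j t) b.view →
      (∃ c' π', P.Votable (E.received j t) j b.view b c' π') → s ≤ t

/-- Fragments are well disseminated in view `v` (with correct leader): if the leader proposes a
view `v` block `b` with reconstruction parameter `k`, then at least `k` processors disseminate
their fragments of `b` upon receiving a votable fragment. -/
def WellDisseminated (v : ℕ) : Prop :=
  ∀ p ∈ E.correct, P.IsLead p v → ∀ b t, E.Proposes p b t → b.view = v →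
    b.tag.k ≤ {j | E.DisseminatesFragment j b}.ncard

end Run

end Carnot

/-! Let `w` run through the views from the first view of the superview up to `v`. By induction on
`w`, no correct processor ever sends nullify(`w`). An N-certificate needs 2f+1 signers, hence a
correct one, so view `w` can then be left only through a view `w` block. A correct leader proposes
only one block `b` per view, and its signature cannot be forged, so that block is `b`.

Let `t` be the time at which the first correct processor enters `w`, and let `δ ≤ Δ`. Certificates
are forwarded on receipt, so by `t + δ` all correct processors have reached `w`. By a time `D` all
processors hold a votable fragment of `b`. In an initial view `D = t + 2δ`: the leader arrives by `t
+ δ` and proposes at once if it has not done so already. In a later view `D = t + δ`, because the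
leader proposed before `t` (`ready_spec`). This situation is recorded in `Spread`, established by
`spread_initial` and `spread_succ`.

By `D` each correct processor has sent a stage-1 vote or already has `b` in `blocks`. By `D + δ`
each has `b` in `blocks*` or `blocks`, and therefore has sent a stage-2 vote (`Spread.vote2`). By `D
+ 2δ` these at least n-f votes have arrived (`Spread.finalised`). Enough fragments arrive for
decoding: in an initial view those of the correct processors other than the leader suffice, as k =
n-f-1; later this is the assumption of good dissemination.

The time-outs leave just enough room. The timer starts no earlier than `t`, so it shows mΔ no
earlier than `D`, when the stage-1 vote is due, and (m+1)Δ no earlier than `D + δ`, when the stage-2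
vote is due. This argument itself uses that nobody has nullified `w` so far; `not_nullified` avoids
the circle by looking at the earliest nullification.

Two general tools support this: invariants along elementary state changes (`IsExecution.invariant`),
together with the properties of states where no instruction has any effect (`Settled`), and an
induction on time that extends unforgeability to the messages of all processors (`genuine_sent`). -/

namespace Carnot

universe u

/-! ### Merkle trees -/

section Merkle

variable {Hash : Type u} (H : Preimage Hash → Hash)

theorem recomputeRoot_merklePath (T : FullTree) (c : ℕ → Bits) (i : ℕ) (hi : i < T.size) :
    recomputeRoot H T i (c i) (merklePath H T c i) = some (merkleRoot H T c) := by
  induction T generalizing c i with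
  | leaf =>
    have : i = 0 := by simpa [FullTree.size] using hi
    subst this
    rfl
  | node l r ihl ihr =>
    simp only [FullTree.size] at hi
    by_cases h : i < l.size
    · simp [merklePath, recomputeRoot, merkleRoot, h, ihl c i h]
    · have h' : i - l.size < r.size := by omega
      have hc : i - l.size + l.size = i := by omega
      have := ihr (fun j => c (j + l.size)) (i - l.size) h'
      simp only [hc] at this
      simp [merklePath, recomputeRoot, merkleRoot, h, this]

/-- Injectivity of the hash peels off one level of the tree at a time, so the root binds the leaf
whatever siblings are claimed. -/
theorem eq_of_recomputeRoot (hH : Function.Injective H) (T : FullTree) (c : ℕ → Bits) (i : ℕ)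
    (hi : i < T.size) (d : Bits) (π : List Hash)
    (h : recomputeRoot H T i d π = some (merkleRoot H T c)) : d = c i := by
  induction T generalizing c i π with
  | leaf =>
    have : i = 0 := by simpa [FullTree.size] using hi
    subst this
    cases π with
    | nil =>
      simp only [recomputeRoot, merkleRoot, Option.some.injEq] at h
      simpa using hH h
    | cons a π => simp [recomputeRoot] at h
  | node l r ihl ihr =>
    simp only [FullTree.size] at hi
    cases π with
    | nil => simp [recomputeRoot] at h
    | cons a π =>
      by_cases hl : i < l.size
      · simp only [recomputeRoot, hl, if_true, Option.map_eq_some_iff, merkleRoot] at h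
        obtain ⟨y, hy, hy'⟩ := h
        have := hH hy'
        simp only [Preimage.node.injEq] at this
        exact ihl c i hl π (by rw [hy, this.1])
      · simp only [recomputeRoot, hl, if_false, Option.map_eq_some_iff, merkleRoot] at h
        obtain ⟨y, hy, hy'⟩ := h
        have := hH hy'
        simp only [Preimage.node.injEq] at this
        have hc : i - l.size + l.size = i := by omega
        have := ihr (fun j => c (j + l.size)) (i - l.size) (by omega) π (by rw [hy, this.2])
        simpa [hc] using this

end Merkle

namespace Params

variable {Hash : Type u} (P : Params Hash)

/-! ### Certified fragments -/

theorem frags_fin (C : Bits) (k : ℕ) (j : Fin P.n) : P.frags C k j = P.code.enc k C j := by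
  simp [frags]

theorem certFrag_enc (htree : P.tree.size = P.n) (C : Bits) (k : ℕ) (hk : 1 ≤ k) (hkn : k ≤ P.n)
    (j : Fin P.n) :
    P.CertFrag (P.tag C k) j (P.code.enc k C j) (merklePath P.H P.tree (P.frags C k) j) := by
  refine ⟨P.code.enc_length k C j hk hkn, ?_⟩
  have := recomputeRoot_merklePath P.H P.tree (P.frags C k) j (by rw [htree]; exact j.2)
  rwa [frags_fin] at this

theorem CertFrag.eq_enc {P : Params Hash} (hH : Function.Injective P.H)
    (htree : P.tree.size = P.n) {C : Bits} {k : ℕ} {j : Fin P.n} {c : Bits} {π : List Hash}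
    (h : P.CertFrag (P.tag C k) j c π) : c = P.code.enc k C j := by
  rw [← frags_fin]
  exact eq_of_recomputeRoot P.H hH P.tree _ j (by rw [htree]; exact j.2) c π h.2

/-- A certified fragment can only be the genuine one, so fragments supplied by faulty processors are
as good for decoding as any others. -/
theorem decode_ne_none (hH : Function.Injective P.H) (htree : P.tree.size = P.n) (C : Bits)
    (k : ℕ) (hk : 1 ≤ k) (hkn : k ≤ P.n) (I : Finset (Fin P.n)) (hI : I.card = k)
    (c : Fin P.n → Bits) (π : Fin P.n → List Hash)
    (h : ∀ j ∈ I, P.CertFrag (P.tag C k) j (c j) (π j)) :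
    P.decode (P.tag C k) (I.image fun j => (j, c j)) ≠ none := by
  have : (I.image fun j => (j, c j)) = I.image fun j => (j, P.code.enc k C j) :=
    Finset.image_congr fun j hj => by
      have := (h j hj).eq_enc hH htree
      simp [this]
  have hr := P.code.reconstruct_enc k C I hk hkn hI
  have : P.decode (P.tag C k) (I.image fun j => (j, c j)) = some C := by
    rw [this]
    simp only [decode]
    rw [show (P.tag C k).k = k from rfl, show (P.tag C k).len = C.length from rfl, hr]
    simp
  simp [this]

theorem IsBlock.k_pos {P : Params Hash} (hn : 4 * P.f + 1 ≤ P.n) (hn2 : 2 ≤ P.n)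
    {b : Block Hash} (hb : P.IsBlock b) : 1 ≤ b.tag.k := by
  have := hb.2.1
  omega

/-! ### Superviews -/

theorem superview_eq_of_mem {u v : ℕ} (hu : P.firstView v ≤ u) (huv : u ≤ v) :
    P.superview u = P.superview v := by
  unfold superview
  unfold firstView at hu
  have h1 : (u - 1) / P.x ≤ (v - 1) / P.x := Nat.div_le_div_right (by omega)
  have h2 : (v - 1) / P.x ≤ (u - 1) / P.x := by
    rcases Nat.eq_zero_or_pos P.x with h | h
    · simp [h]
    · rw [Nat.le_div_iff_mul_le h]; omega
  omega

theorem firstView_eq_of_superview_eq {u v : ℕ} (h : P.superview u = P.superview v) :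
    P.firstView u = P.firstView v := by
  unfold superview at h
  unfold firstView
  rw [show (u - 1) / P.x = (v - 1) / P.x by omega]

theorem firstView_pos (v : ℕ) : 1 ≤ P.firstView v := by simp [firstView]

theorem firstView_le {v : ℕ} (hv : 1 ≤ v) : P.firstView v ≤ v := by
  unfold firstView
  have := Nat.div_mul_le_self (v - 1) P.x
  omega

theorem initial_iff {v : ℕ} (hv : 1 ≤ v) : P.Initial v ↔ P.firstView v = v := by
  unfold Initial firstView
  have h := Nat.div_add_mod (v - 1) P.x
  rw [mul_comm] at h
  obtain ⟨w, rfl⟩ : ∃ w, v = w + 1 := ⟨v - 1, by omega⟩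
  simp only [Nat.add_sub_cancel] at h ⊢
  have h1 : w + 1 ≡ 1 [MOD P.x] ↔ w ≡ 0 [MOD P.x] := by
    constructor
    · intro h
      exact Nat.ModEq.add_right_cancel' 1 (by simpa using h)
    · intro h
      simpa using h.add_right 1
  rw [h1, Nat.modEq_zero_iff_dvd, Nat.dvd_iff_mod_eq_zero]
  omega

theorem initial_firstView (v : ℕ) : P.Initial (P.firstView v) := by
  rw [initial_iff P (P.firstView_pos v)]
  unfold firstView
  rcases Nat.eq_zero_or_pos P.x with h | h
  · simp [h]
  · simp [Nat.mul_div_cancel _ h]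

theorem not_initial_of_mem {u v : ℕ} (hu : P.firstView v < u) (huv : u ≤ v) : ¬ P.Initial u := by
  have h1 := P.firstView_pos v
  rw [initial_iff P (by omega), P.firstView_eq_of_superview_eq (P.superview_eq_of_mem hu.le huv)]
  omega

theorem not_initial_succ {v : ℕ} (hv : 1 ≤ v) (h : P.superview (v + 1) = P.superview v) :
    ¬ P.Initial (v + 1) := by
  have := P.firstView_le hv
  rw [initial_iff P (by omega), P.firstView_eq_of_superview_eq h]
  omega

theorem superview_succ {v : ℕ} (hv : 1 ≤ v) (h : ¬ P.Initial (v + 1)) :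
    P.superview v = P.superview (v + 1) := by
  have h1 := P.firstView_le (v := v + 1) (by omega)
  rw [initial_iff P (by omega)] at h
  exact P.superview_eq_of_mem (by omega) (by omega)

theorem IsLead.congr {P : Params Hash} {p : Fin P.n} {u v : ℕ} (h : P.IsLead p u)
    (huv : P.superview u = P.superview v) : P.IsLead p v := by
  unfold IsLead at *
  rw [h, huv]

theorem IsLead.unique {P : Params Hash} {p q : Fin P.n} {v : ℕ} (hp : P.IsLead p v)
    (hq : P.IsLead q v) : p = q := Fin.ext (hp.trans hq.symm)

/-! ### Monotonicity in the received messages -/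

variable {P} {S S' : Mail Hash P.n}

theorem Certs.mono (h : S ⊆ S') {m : Msg Hash P.n} (hm : P.Certs S m) : P.Certs S' m := by
  have key : ∀ g : Fin P.n → Msg Hash P.n,
      {i | ∃ q, (q, g i) ∈ S}.ncard ≤ {i | ∃ q, (q, g i) ∈ S'}.ncard := fun g =>
    Set.ncard_le_ncard (fun i ⟨q, hq⟩ => ⟨q, h hq⟩) (Set.toFinite _)
  cases hm with
  | mcert q b hq => exact .mcert q b (h hq)
  | cert q b hq => exact .cert q b (h hq)
  | ncert q v hq => exact .ncert q v (h hq)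
  | formM b hb => exact .formM b (hb.trans (key _))
  | form b hb => exact .form b (hb.trans (key _))
  | formN v hv => exact .formN v (hv.trans (key _))

/-- Received messages enter `blocks` only through M-certificates. Forwarding these therefore passes
on whole chains of blocks. -/
theorem Blocks.of_certs (h : ∀ b, P.Certs S (.mcert b) → P.Certs S' (.mcert b))
    {b : Block Hash} (hb : P.Blocks S b) : P.Blocks S' b := by
  induction hb with
  | gen => exact .gen
  | step b b' h1 h2 _ h4 ih => exact .step b b' h1 (h b h2) ih h4

theorem Blocks.mono (h : S ⊆ S') {b : Block Hash} (hb : P.Blocks S b) : P.Blocks S' b :=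
  hb.of_certs fun _ hc => hc.mono h

theorem Blocks.mcert {b : Block Hash} (hb : P.Blocks S b) (hv : 1 ≤ b.view) :
    P.Certs S (.mcert b) := by
  cases hb with
  | gen => simp [genesis] at hv
  | step b b' h1 h2 h3 h4 => exact h2

theorem Notarised1.mono (h : S ⊆ S') {b : Block Hash} (hb : P.Notarised1 S b) :
    P.Notarised1 S' b := by
  unfold Notarised1 at *
  have : {i | ∃ q, (q, Msg.vote1 b i) ∈ S}.ncard ≤ {i | ∃ q, (q, Msg.vote1 b i) ∈ S'}.ncard :=
    Set.ncard_le_ncard (fun i ⟨q, hq⟩ => ⟨q, h hq⟩) (Set.toFinite _)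
  omega

theorem BlocksStar.mono (h : S ⊆ S') {b : Block Hash} (hb : P.BlocksStar S b) :
    P.BlocksStar S' b := by
  rcases hb with hb | ⟨h1, h2, ⟨I, c, π, hI, hf, hd⟩, b', hb', hp⟩
  · exact .inl hb
  · exact .inr ⟨h1, h2.mono h, ⟨I, c, π, hI, fun j hj => ⟨h (hf j hj).1, (hf j hj).2⟩, hd⟩,
      b', hb'.mono h, hp⟩

theorem Votable.mono (h : S ⊆ S') {i : Fin P.n} {v : ℕ} {b : Block Hash} {c : Bits}
    {π : List Hash} (hb : P.Votable S i v b c π) : P.Votable S' i v b c π := by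
  obtain ⟨⟨q, hq⟩, h1, h2, h3, b', h4, h5, h6, h7⟩ := hb
  exact ⟨⟨q, h hq⟩, h1, h2, h3, b', h4.mono h, h5, h6, fun u hu hu' => (h7 u hu hu').mono h⟩

theorem Reached.mono (h : S ⊆ S') {v : ℕ} (hv : P.Reached S v) : P.Reached S' v := by
  intro u hu huv
  rcases hv u hu huv with h1 | ⟨b, h1, h2⟩
  · exact .inl (h1.mono h)
  · exact .inr ⟨b, h1.mono h, h2⟩

end Params

/-! ### The order on the states within a timeslot -/

/-- `s'` may follow `s` within a timeslot. -/
structure LState.Le {Hash : Type u} {n : ℕ} (s s' : LState Hash n) : Prop where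
  view : s.view ≤ s'.view
  nullified : s.nullified ⊆ s'.nullified
  voted1 : s.voted1 ⊆ s'.voted1
  voted2 : s.voted2 ⊆ s'.voted2
  proposed : s.proposed ⊆ s'.proposed
  viaBlock : s.viaBlock ⊆ s'.viaBlock
  out : s.out ⊆ s'.out
  par : s.view = s'.view → s.par = s'.par
  T : s.view = s'.view → s.T = s'.T

/-- The persistent part of the local state only grows. -/
structure LState.Grows {Hash : Type u} {n : ℕ} (s s' : LState Hash n) : Prop where
  view : s.view ≤ s'.view
  nullified : s.nullified ⊆ s'.nullified
  voted1 : s.voted1 ⊆ s'.voted1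
  voted2 : s.voted2 ⊆ s'.voted2
  proposed : s.proposed ⊆ s'.proposed
  viaBlock : s.viaBlock ⊆ s'.viaBlock

theorem LState.Le.refl {Hash : Type u} {n : ℕ} (s : LState Hash n) : s.Le s :=
  ⟨le_rfl, subset_rfl, subset_rfl, subset_rfl, subset_rfl, subset_rfl, subset_rfl, fun _ => rfl,
    fun _ => rfl⟩

theorem LState.Le.trans {Hash : Type u} {n : ℕ} {s₁ s₂ s₃ : LState Hash n} (h : s₁.Le s₂)
    (h' : s₂.Le s₃) : s₁.Le s₃ where
  view := h.view.trans h'.view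
  nullified := h.nullified.trans h'.nullified
  voted1 := h.voted1.trans h'.voted1
  voted2 := h.voted2.trans h'.voted2
  proposed := h.proposed.trans h'.proposed
  viaBlock := h.viaBlock.trans h'.viaBlock
  out := h.out.trans h'.out
  par e := by
    have h1 := h.view
    have h2 := h'.view
    rw [h.par (by omega), h'.par (by omega)]
  T e := by
    have h1 := h.view
    have h2 := h'.view
    rw [h.T (by omega), h'.T (by omega)]

/-- This serves for a pass that ends where it began: all its intermediate states must then coincide.
The fields `par` and `T` are compared only within one view, since entering a view may overwrite
them; this suffices because the view is itself monotone. -/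
theorem LState.Le.antisymm {Hash : Type u} {n : ℕ} {s s' : LState Hash n} (h : s.Le s')
    (h' : s'.Le s) : s = s' := by
  have hv := le_antisymm h.view h'.view
  have h1 := h.nullified.antisymm h'.nullified
  have h2 := h.voted1.antisymm h'.voted1
  have h3 := h.voted2.antisymm h'.voted2
  have h4 := h.proposed.antisymm h'.proposed
  have h5 := h.viaBlock.antisymm h'.viaBlock
  have h6 := h.out.antisymm h'.out
  have h7 := h.par hv
  have h8 := h.T hv
  cases s
  cases s'
  simp_all

theorem Ctx.S_mono {Hash : Type u} {n : ℕ} (K : Ctx Hash n) {s s' : LState Hash n}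
    (h : s.out ⊆ s'.out) : K.S s ⊆ K.S s' :=
  Set.union_subset_union_right _ fun _ hy => ⟨h hy.1, hy.2⟩

theorem Ctx.inbox_subset_S {Hash : Type u} {n : ℕ} (K : Ctx Hash n) (s : LState Hash n) :
    K.inbox ⊆ K.S s := Set.subset_union_left

/-! ### Elementary state changes within a timeslot -/

namespace Params

variable {Hash : Type u} (P : Params Hash) (K : Ctx Hash P.n)

/-- What is sure when a correct processor times out in the state `s`: the messages received from
others, and its own earlier ones, did not call for a vote or for leaving the view. -/
structure TimesOut (s : LState Hash P.n) : Prop where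
  notMem : s.view ∉ s.nullified
  ready : P.TimeoutReady s
  voted1 : ∀ b c π, P.Votable K.inbox K.p s.view b c π → s.view ∈ s.voted1
  voted2 : ∀ b, P.BlocksStar K.inbox b → b.view = s.view → s.view ∈ s.voted2
  blocks : ∀ b, P.Blocks K.inbox b → b.view ≠ s.view

/-- The elementary changes of state. -/
inductive Micro : LState Hash P.n → LState Hash P.n → Prop
  | certs (s) : Micro s (s.send {y | P.Certs (K.S s) y.2 ∧ y.2 ∉ K.known})
  | propose (s) (v : ℕ) (b : Block Hash) (C : Bits) (k : ℕ) : P.ProposeTarget K s v b →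
      P.n ≤ k + P.f + 1 → k + 1 ≤ P.n → (P.Initial v → P.n = k + P.f + 1) →
      Micro s { s with
        proposed := insert ⟨v, P.tag C k, some (P.H (.block b))⟩ s.proposed
        out := s.out ∪ Set.range fun j : Fin P.n =>
          (j, .frag ⟨v, P.tag C k, some (P.H (.block b))⟩ j (P.code.enc k C j)
            (merklePath P.H P.tree (P.frags C k) j)) }
  | vote1 (s) (b : Block Hash) (c : Bits) (π : List Hash) : P.Votable (K.S s) K.p s.view b c π →
      Micro s { s with
        voted1 := insert s.view s.voted1
        out := s.out ∪ toAll (.vote1 b K.p) ∪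
          {y | ¬ P.IsLead K.p s.view ∧ y ∈ toAll (.frag b K.p c π)} }
  | vote2 (s) (b : Block Hash) : P.BlocksStar (K.S s) b ∨ P.Blocks (K.S s) b → b.view = s.view →
      Micro s (P.vote2 K s b)
  | advance (s) (b : Block Hash) : P.Blocks (K.S s) b → b.view = s.view →
      s.view ∈ s.voted2 ∨ s.view ∈ s.nullified → Micro s (P.advance s b)
  | timeout (s) : P.TimesOut K s →
      Micro s { s with
        nullified := s.nullified ∪ {v | s.view ≤ v ∧ P.superview v = P.superview s.view}
        out := s.out ∪ {y | ∃ v, s.view ≤ v ∧ P.superview v = P.superview s.view ∧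
          y ∈ toAll (.nullify v K.p)} }
  | null (s) : P.Certs (K.S s) (.ncert s.view) → Micro s { s with view := s.view + 1, T := 0 }

variable {P K} {s s' : LState Hash P.n}

theorem Micro.le (h : P.Micro K s s') : s.Le s' := by
  cases h with
  | certs => constructor <;> simp [LState.send]
  | propose v b C k => constructor <;> simp
  | vote1 b c π =>
    constructor <;> try simp
    rw [Set.union_assoc]; exact Set.subset_union_left
  | vote2 b => constructor <;> simp [Params.vote2]
  | advance b => constructor <;> simp [Params.advance]
  | timeout => constructor <;> simp
  | null => constructor <;> simp

theorem le_of_micros (h : Relation.ReflTransGen (P.Micro K) s s') : s.Le s' := by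
  induction h with
  | refl => exact .refl _
  | tail _ h ih => exact ih.trans h.le

open Relation

theorem CertLine.micros (h : P.CertLine K s s') : ReflTransGen (P.Micro K) s s' := by
  rw [CertLine] at h
  subst h
  exact .single (.certs s)

theorem ProposeLine.micros (h : P.ProposeLine K s s') : ReflTransGen (P.Micro K) s s' := by
  rcases h with ⟨v, b, C, k, h1, h2, h3, h4, rfl⟩ | ⟨_, rfl⟩
  · exact .single (.propose s v b C k h1 h2 h3 h4)
  · exact .refl

theorem Vote1Line.micros (h : P.Vote1Line K s s') : ReflTransGen (P.Micro K) s s' := by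
  rcases h with ⟨b, c, π, h1, _, rfl⟩ | ⟨_, rfl⟩
  · exact .single (.vote1 s b c π h1)
  · exact .refl

theorem Vote2Line.micros (h : P.Vote2Line K s s') : ReflTransGen (P.Micro K) s s' := by
  rcases h with ⟨b, h1, h2, _, rfl⟩ | ⟨_, rfl⟩
  · exact .single (.vote2 s b (.inl h1) h2)
  · exact .refl

theorem BlockLine.micros (h : P.BlockLine K s s') : ReflTransGen (P.Micro K) s s' := by
  rcases h with ⟨b, h1, h2, ⟨_, rfl⟩ | ⟨h3, rfl⟩⟩ | ⟨_, rfl⟩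
  · refine .head (.vote2 s b (.inr h1) h2) (.single (.advance _ b (h1.mono ?_) h2 (.inl ?_)))
    · exact K.S_mono (by simp [vote2])
    · simp [vote2]
  · refine .single (.advance s b h1 h2 ?_)
    unfold MayVote2 at h3
    tauto
  · exact .refl

theorem NullLine.micros (h : P.NullLine K s s') : ReflTransGen (P.Micro K) s s' := by
  rcases h with ⟨h1, rfl⟩ | ⟨_, rfl⟩
  · exact .single (.null s h1)
  · exact .refl

theorem TimeoutLine.micros (h0 : P.TimeoutReady s → s.view ∉ s.nullified → P.TimesOut K s)
    (h : P.TimeoutLine K s s') : ReflTransGen (P.Micro K) s s' := by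
  rcases h with ⟨h1, h2, rfl⟩ | ⟨_, rfl⟩
  · exact .single (.timeout s (h0 h2 h1))
  · exact .refl

/-- Entering a view resets the timer to 0, so no time-out can happen in the timeslot of entry. -/
theorem TimeoutReady.T_pos (hΔ : 0 < P.Δ) (h : P.TimeoutReady s) : 0 < s.T := by
  unfold TimeoutReady at h
  omega

theorem Pass.micros (hΔ : 0 < P.Δ) (h : P.Pass K s s') : ReflTransGen (P.Micro K) s s' := by
  obtain ⟨s₁, s₂, s₃, s₄, s₅, s₆, h1, h2, h3, h4, h5, h6, h7⟩ := h
  refine h1.micros.trans (h2.micros.trans (h3.micros.trans (h4.micros.trans (h5.micros.trans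
    (.trans (h6.micros fun hr hn => ?_) h7.micros)))))
  have l34 := le_of_micros h4.micros
  have l23 := le_of_micros h3.micros
  -- Had the block instruction fired, the timer would now be 0.
  have e45 : s₅ = s₄ ∧ ¬ ∃ b, P.Blocks (K.S s₄) b ∧ b.view = s₄.view := by
    have := hr.T_pos hΔ
    rcases h5 with ⟨b, _, _, ⟨_, rfl⟩ | ⟨_, rfl⟩⟩ | ⟨h, rfl⟩
    · simp [advance] at this
    · simp [advance] at this
    · exact ⟨rfl, h⟩
  obtain ⟨rfl, hb⟩ := e45
  have v34 : s₃.view = s₅.view := by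
    rcases h4 with ⟨b, _, _, _, rfl⟩ | ⟨_, rfl⟩ <;> rfl
  have v23 : s₂.view = s₃.view := by
    rcases h3 with ⟨b, c, π, _, _, rfl⟩ | ⟨_, rfl⟩ <;> rfl
  -- The inbox is part of what every state of the timeslot sees, so the voting and block
  -- instructions of this very pass have already reacted to it.
  refine ⟨hn, hr, fun b c π hv => ?_, fun b hb' hv => ?_, fun b hb' hv => ?_⟩
  · apply l34.voted1
    rw [← v34, ← v23] at hv ⊢
    rcases h3 with ⟨b, c, π, _, _, rfl⟩ | ⟨h, rfl⟩
    · simp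
    · by_contra hc
      exact h ⟨b, c, π, hv.mono (K.inbox_subset_S _), hc⟩
  · rcases h4 with ⟨b', _, _, _, rfl⟩ | ⟨h, rfl⟩
    · simp [vote2]
    · by_contra hc
      exact h ⟨b, hb'.mono (K.inbox_subset_S _), hv, hn, hc⟩
  · exact hb ⟨b, hb'.mono (K.inbox_subset_S _), hv⟩

theorem Slot.micros (hΔ : 0 < P.Δ) (h : P.Slot K s s') : ReflTransGen (P.Micro K) s s' := by
  have key : ∀ s', ReflTransGen (P.Pass K) s s' → ReflTransGen (P.Micro K) s s' := by
    intro s' h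
    induction h with
    | refl => exact .refl
    | tail _ h ih => exact ih.trans (h.micros hΔ)
  exact key s' h.1

/-! ### States in which no instruction has any further effect -/

variable (P K s) in
/-- What holds in a state in which no instruction has any further effect. -/
structure Settled : Prop where
  certs : ∀ m, P.Certs (K.S s) m → m ∉ K.known → ∀ q, (q, m) ∈ s.out
  fresh : P.IsLead K.p s.view → ¬ P.FreshSuperview s
  votable : ∀ b c π, P.Votable (K.S s) K.p s.view b c π → s.view ∈ s.voted1
  star : ∀ b, P.BlocksStar (K.S s) b → b.view = s.view → s.view ∈ s.voted2 ∨ s.view ∈ s.nullified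
  blocks : ∀ b, P.Blocks (K.S s) b → b.view ≠ s.view
  ncert : ¬ P.Certs (K.S s) (.ncert s.view)

/-- By antisymmetry every instruction of the pass leaves the state fixed. An instruction that fired
would have left a visible trace, namely a flag, a proposal or a larger view; either the trace was
already there or this is a contradiction. -/
theorem Pass.settled (h : P.Pass K s s) : P.Settled K s := by
  obtain ⟨s₁, s₂, s₃, s₄, s₅, s₆, h1, h2, h3, h4, h5, h6, h7⟩ := id h
  have l1 := le_of_micros h1.micros
  have l2 := le_of_micros h2.micros
  have l3 := le_of_micros h3.micros
  have l4 := le_of_micros h4.micros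
  have l5 := le_of_micros h5.micros
  have l6 : s₅.Le s₆ := by
    rcases h6 with ⟨_, _, rfl⟩ | ⟨_, rfl⟩
    · constructor <;> simp
    · exact .refl _
  have l7 := le_of_micros h7.micros
  obtain rfl := l1.antisymm (l2.trans (l3.trans (l4.trans (l5.trans (l6.trans l7)))))
  obtain rfl := l2.antisymm (l3.trans (l4.trans (l5.trans (l6.trans l7))))
  obtain rfl := l3.antisymm (l4.trans (l5.trans (l6.trans l7)))
  obtain rfl := l4.antisymm (l5.trans (l6.trans l7))
  obtain rfl := l5.antisymm (l6.trans l7)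
  obtain rfl := l6.antisymm l7
  refine ⟨fun m hm hk q => ?_, fun hl hf => ?_, fun b c π hv => ?_, fun b hb hv => ?_,
    fun b hb hv => ?_, fun hc => ?_⟩
  · rw [h1]
    exact .inr ⟨hm, hk⟩
  · rcases h2 with ⟨v, b, C, k, ⟨_, ⟨_, rfl, _⟩ | ⟨hf', _⟩⟩, _, _, _, he⟩ | ⟨hno, _⟩
    · refine hf.2 ⟨s.view, P.tag C k, some (P.H (.block b))⟩ ?_ rfl
      rw [congrArg LState.proposed he]
      exact .inl rfl
    · exact hf' hf
    · exact hno ⟨s.view, s.par, hl, .inl ⟨hf, rfl, rfl⟩⟩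
  · by_contra hc
    rcases h3 with ⟨_, _, _, _, _, he⟩ | ⟨hno, _⟩
    · rw [congrArg LState.voted1 he] at hc
      exact hc (.inl rfl)
    · exact hno ⟨b, c, π, hv, hc⟩
  · by_contra hc
    rcases h4 with ⟨_, _, _, _, he⟩ | ⟨hno, _⟩
    · rw [congrArg LState.voted2 he] at hc
      exact hc (.inl (.inl rfl))
    · unfold MayVote2 at hno
      exact hno ⟨b, hb, hv, by tauto⟩
  · rcases h5 with ⟨_, _, _, ⟨_, he⟩ | ⟨_, he⟩⟩ | ⟨hno, _⟩
    · simpa [advance, vote2] using congrArg LState.view he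
    · simpa [advance] using congrArg LState.view he
    · exact hno ⟨b, hb, hv⟩
  · rcases h7 with ⟨_, he⟩ | ⟨hno, _⟩
    · simpa using congrArg LState.view he
    · exact hno hc

end Params

open Relation

namespace Run

variable {Hash : Type u} {P : Params Hash} (E : Run P)

/-! ### States within timeslots -/

open Classical in
/-- The state of `p` at the beginning of timeslot `t`. -/
noncomputable def entry (p : Fin P.n) (t : ℕ) : LState Hash P.n :=
  if t = E.start p then P.init else P.tick (E.st p (t - 1))

/-- The state `s` occurs in the course of timeslot `t` of processor `p`. -/
structure InSlot (p : Fin P.n) (t : ℕ) (s : LState Hash P.n) : Prop where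
  start_le : E.start p ≤ t
  before : ReflTransGen (P.Micro (E.ctx p t)) (E.entry p t) s
  after : ReflTransGen (P.Micro (E.ctx p t)) s (E.st p t)

variable {E} {p : Fin P.n} {t : ℕ} {s : LState Hash P.n}

theorem InSlot.le (h : E.InSlot p t s) : s.Le (E.st p t) := Params.le_of_micros h.after

theorem IsExecution.entry_slot (hE : E.IsExecution) (hp : p ∈ E.correct) (ht : E.start p ≤ t) :
    P.Slot (E.ctx p t) (E.entry p t) (E.st p t) := by
  unfold entry
  split_ifs with h
  · subst h
    exact hE.slot_first p hp
  · have := hE.slot_next p hp (t - 1) (by omega)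
    rwa [Nat.sub_add_cancel (by omega)] at this

theorem IsExecution.inSlot_st (hE : E.IsExecution) (hΔ : 0 < P.Δ) (hp : p ∈ E.correct)
    (ht : E.start p ≤ t) : E.InSlot p t (E.st p t) :=
  ⟨ht, (hE.entry_slot hp ht).micros hΔ, .refl⟩

theorem IsExecution.settled (hE : E.IsExecution) (hp : p ∈ E.correct) (ht : E.start p ≤ t) :
    P.Settled (E.ctx p t) (E.st p t) := (hE.entry_slot hp ht).2.settled

/-- Induction over the course of the states of a correct processor. -/
theorem IsExecution.invariant (hE : E.IsExecution) (hΔ : 0 < P.Δ) (hp : p ∈ E.correct)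
    {Q : ℕ → LState Hash P.n → Prop} (init : Q (E.start p) P.init)
    (tick : ∀ t, E.start p ≤ t → Q t (E.st p t) → Q (t + 1) (P.tick (E.st p t)))
    (step : ∀ t s s', E.InSlot p t s → E.InSlot p t s' → P.Micro (E.ctx p t) s s' → Q t s →
      Q t s')
    (h : E.InSlot p t s) : Q t s := by
  have slot : ∀ t, Q t (E.entry p t) → ∀ s, E.InSlot p t s → Q t s := by
    intro t h0 s hs
    obtain ⟨h1, h2, h3⟩ := hs
    induction h2 with
    | refl => exact h0
    | tail ha hb ih =>
      exact step t _ _ ⟨h1, ha, .head hb h3⟩ ⟨h1, .tail ha hb, h3⟩ hb (ih (.head hb h3))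
  have main : ∀ t, E.start p ≤ t → Q t (E.entry p t) := by
    intro t ht
    induction t, ht using Nat.le_induction with
    | base => simpa [entry] using init
    | succ t ht ih =>
      have := tick t ht (slot t ih _ (hE.inSlot_st hΔ hp ht))
      unfold entry
      rwa [if_neg (by omega), Nat.add_sub_cancel]
  exact slot t (main t h.start_le) s h

theorem IsExecution.grows (hE : E.IsExecution) (hΔ : 0 < P.Δ) (hp : p ∈ E.correct)
    (ht : E.start p ≤ t) {t' : ℕ} (htt : t ≤ t') : (E.st p t).Grows (E.st p t') := by
  induction t', htt using Nat.le_induction with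
  | base => constructor <;> simp
  | succ t' h ih =>
    have := Params.le_of_micros ((hE.slot_next p hp t' (by omega)).micros hΔ)
    exact ⟨ih.view.trans this.view, ih.nullified.trans this.nullified,
      ih.voted1.trans this.voted1, ih.voted2.trans this.voted2, ih.proposed.trans this.proposed,
      ih.viaBlock.trans this.viaBlock⟩

/-! ### Received messages -/

theorem fromOthers_mono (E : Run P) (p : Fin P.n) {t t' : ℕ} (h : t ≤ t') :
    E.fromOthers p t ⊆ E.fromOthers p t' :=
  fun _ ⟨h1, s, h2, h3⟩ => ⟨h1, s, h2, h3.trans h⟩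

theorem inbox_mono (E : Run P) (p : Fin P.n) {t t' : ℕ} (h : t ≤ t') :
    (E.ctx p t).inbox ⊆ (E.ctx p t').inbox :=
  Set.union_subset_union (E.fromOthers_mono p h)
    fun _ ⟨h1, s, h2, h3⟩ => ⟨h1, s, h2.trans_le h, h3⟩

theorem inbox_subset_received (E : Run P) (p : Fin P.n) (t : ℕ) :
    (E.ctx p t).inbox ⊆ E.received p t :=
  Set.union_subset_union_right _ fun _ ⟨h1, s, h2, h3⟩ => ⟨h1, s, h2.le, h3⟩

theorem received_subset_inbox (E : Run P) (p : Fin P.n) (t : ℕ) :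
    E.received p t ⊆ (E.ctx p (t + 1)).inbox :=
  Set.union_subset_union (E.fromOthers_mono p t.le_succ)
    fun _ ⟨h1, s, h2, h3⟩ => ⟨h1, s, Nat.lt_succ_of_le h2, h3⟩

theorem received_mono (E : Run P) (p : Fin P.n) {t t' : ℕ} (h : t ≤ t') :
    E.received p t ⊆ E.received p t' :=
  Set.union_subset_union (E.fromOthers_mono p h)
    fun _ ⟨h1, s, h2, h3⟩ => ⟨h1, s, h2.trans h, h3⟩

/-- Own messages of the current timeslot count as received at once, and `out` at the end of the
timeslot is exactly what is sent in it. -/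
theorem IsExecution.S_st (hE : E.IsExecution) (hp : p ∈ E.correct) (ht : E.start p ≤ t) :
    (E.ctx p t).S (E.st p t) = E.received p t := by
  have h := hE.sent_eq p hp t ht
  ext y
  simp only [Ctx.S, ctx, received, Set.mem_union, Set.mem_ofPred_eq, ← h]
  constructor
  · rintro ((h | ⟨h1, s, h2, h3⟩) | ⟨h1, h2⟩)
    · exact .inl h
    · exact .inr ⟨h1, s, h2.le, h3⟩
    · exact .inr ⟨h2, t, le_rfl, h1⟩
  · rintro (h | ⟨h1, s, h2, h3⟩)
    · exact .inl (.inl h)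
    · rcases h2.lt_or_eq with h2 | rfl
      · exact .inl (.inr ⟨h1, s, h2, h3⟩)
      · exact .inr ⟨h3, h1⟩

theorem IsExecution.S_tick (hE : E.IsExecution) (hp : p ∈ E.correct) (ht : E.start p ≤ t) :
    (E.ctx p t).S (E.st p t) ⊆ (E.ctx p (t + 1)).S (P.tick (E.st p t)) := by
  rw [hE.S_st hp ht]
  exact (E.received_subset_inbox p t).trans (Ctx.inbox_subset_S _ _)

/-- What `p` has sent before timeslot `t`, or in this timeslot up to the state `s`. -/
def outbox (E : Run P) (p : Fin P.n) (t : ℕ) (s : LState Hash P.n) : Mail Hash P.n :=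
  s.out ∪ {y | ∃ t' < t, y ∈ E.sent p t'}

theorem outbox_mono {s s' : LState Hash P.n} (h : s.out ⊆ s'.out) :
    E.outbox p t s ⊆ E.outbox p t s' := Set.union_subset_union_left _ h

theorem IsExecution.outbox_tick (hE : E.IsExecution) (hp : p ∈ E.correct) (ht : E.start p ≤ t) :
    E.outbox p t (E.st p t) ⊆ E.outbox p (t + 1) (P.tick (E.st p t)) := by
  rintro y (hy | ⟨t', h1, h2⟩)
  · exact .inr ⟨t, t.lt_succ_self, by rwa [hE.sent_eq p hp t ht]⟩
  · exact .inr ⟨t', by omega, h2⟩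

theorem IsExecution.mem_outbox_st (hE : E.IsExecution) (hp : p ∈ E.correct) (ht : E.start p ≤ t)
    {y : Fin P.n × Msg Hash P.n} :
    y ∈ E.outbox p t (E.st p t) ↔ ∃ t' ≤ t, y ∈ E.sent p t' := by
  constructor
  · rintro (hy | ⟨t', h1, h2⟩)
    · exact ⟨t, le_rfl, by rwa [hE.sent_eq p hp t ht]⟩
    · exact ⟨t', h1.le, h2⟩
  · rintro ⟨t', h1, h2⟩
    rcases h1.lt_or_eq with h1 | rfl
    · exact .inr ⟨t', h1, h2⟩
    · rw [hE.sent_eq p hp t' ht] at h2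
      exact .inl h2

/-! ### Invariants of a correct processor -/

theorem InSlot.view_pos (h : E.InSlot p t s) (hE : E.IsExecution) (hΔ : 0 < P.Δ)
    (hp : p ∈ E.correct) : 1 ≤ s.view :=
  hE.invariant hΔ hp (Q := fun _ s => 1 ≤ s.view) le_rfl (fun _ _ h => h)
    (fun _ _ _ _ _ h hs => hs.trans h.le.view) h

/-- The timer shows the time since the processor entered its view. -/
theorem InSlot.timer (h : E.InSlot p t s) (hE : E.IsExecution) (hΔ : 0 < P.Δ)
    (hp : p ∈ E.correct) :
    ∃ t₁, E.start p ≤ t₁ ∧ t = t₁ + s.T ∧ s.view ≤ (E.st p t₁).view := by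
  refine hE.invariant hΔ hp (Q := fun t s => ∃ t₁, E.start p ≤ t₁ ∧ t = t₁ + s.T ∧
    s.view ≤ (E.st p t₁).view) ?_ ?_ ?_ h
  · exact ⟨E.start p, le_rfl, rfl, (hE.inSlot_st hΔ hp le_rfl).view_pos hE hΔ hp⟩
  · rintro t ht ⟨t₁, h1, h2, h3⟩
    exact ⟨t₁, h1, by simp only [Params.tick]; omega, h3⟩
  · intro t s s' _ hs' hm ih
    cases hm with
    | advance b => exact ⟨t, hs'.start_le, rfl, hs'.le.view⟩
    | null => exact ⟨t, hs'.start_le, rfl, hs'.le.view⟩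
    | _ => exact ih

/-- The variable `b` of the protocol: its value is in `blocks`, and all later views were left by
means of N-certificates. -/
theorem InSlot.par (h : E.InSlot p t s) (hE : E.IsExecution) (hΔ : 0 < P.Δ)
    (hp : p ∈ E.correct) :
    P.Blocks ((E.ctx p t).S s) s.par ∧ s.par.view < s.view ∧
      ∀ u, s.par.view < u → u < s.view → P.Certs ((E.ctx p t).S s) (.ncert u) := by
  refine hE.invariant hΔ hp (Q := fun t s => P.Blocks ((E.ctx p t).S s) s.par ∧
    s.par.view < s.view ∧
      ∀ u, s.par.view < u → u < s.view → P.Certs ((E.ctx p t).S s) (.ncert u)) ?_ ?_ ?_ h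
  · exact ⟨.gen, by simp [Params.init, Params.genesis], fun u h1 h2 => by
      simp only [Params.init, Params.genesis] at h1 h2; omega⟩
  · rintro t ht ⟨h1, h2, h3⟩
    have := hE.S_tick hp ht
    exact ⟨h1.mono this, h2, fun u hu hu' => (h3 u hu hu').mono this⟩
  · rintro t s s' hs _ hm ⟨h1, h2, h3⟩
    have hS := Ctx.S_mono (E.ctx p t) hm.le.out
    have keep : P.Blocks ((E.ctx p t).S s') s.par ∧ s.par.view < s.view ∧
      ∀ u, s.par.view < u → u < s.view → P.Certs ((E.ctx p t).S s') (.ncert u) :=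
      ⟨h1.mono hS, h2, fun u hu hu' => (h3 u hu hu').mono hS⟩
    cases hm with
    | advance b hb hv _ =>
      refine ⟨hb.mono hS, by simp [Params.advance, hv], fun u hu hu' => ?_⟩
      simp only [Params.advance] at hu hu'
      omega
    | null hc =>
      refine ⟨keep.1, Nat.lt_succ_of_lt h2, fun u hu hu' => ?_⟩
      rcases (Nat.lt_succ_iff_lt_or_eq.1 hu') with hu' | rfl
      · exact keep.2.2 u hu hu'
      · exact hc.mono hS
    | _ => exact keep

/-- How the views before the present one were left. -/
theorem InSlot.left (h : E.InSlot p t s) (hE : E.IsExecution) (hΔ : 0 < P.Δ)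
    (hp : p ∈ E.correct) {u : ℕ} (hu : 1 ≤ u) (hus : u < s.view) :
    (u + 1 ∈ s.viaBlock ∧ (∃ b, P.Blocks ((E.ctx p t).S s) b ∧ b.view = u) ∧
      (u ∈ s.voted2 ∨ u ∈ s.nullified)) ∨ P.Certs ((E.ctx p t).S s) (.ncert u) := by
  refine hE.invariant hΔ hp (Q := fun t s => ∀ u, 1 ≤ u → u < s.view →
    (u + 1 ∈ s.viaBlock ∧ (∃ b, P.Blocks ((E.ctx p t).S s) b ∧ b.view = u) ∧
      (u ∈ s.voted2 ∨ u ∈ s.nullified)) ∨ P.Certs ((E.ctx p t).S s) (.ncert u)) ?_ ?_ ?_ h u hu hus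
  · intro u h1 h2
    simp only [Params.init] at h2
    omega
  · intro t ht ih u h1 h2
    have := hE.S_tick hp ht
    rcases ih u h1 h2 with ⟨h3, ⟨b, h4, h5⟩, h6⟩ | h3
    · exact .inl ⟨h3, ⟨b, h4.mono this, h5⟩, h6⟩
    · exact .inr (h3.mono this)
  · intro t s s' hs _ hm ih
    have hS := Ctx.S_mono (E.ctx p t) hm.le.out
    have hle := hm.le
    have keep : ∀ u, 1 ≤ u → u < s.view →
        (u + 1 ∈ s'.viaBlock ∧ (∃ b, P.Blocks ((E.ctx p t).S s') b ∧ b.view = u) ∧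
          (u ∈ s'.voted2 ∨ u ∈ s'.nullified)) ∨ P.Certs ((E.ctx p t).S s') (.ncert u) := by
      intro u h1 h2
      rcases ih u h1 h2 with ⟨h3, ⟨b, h4, h5⟩, h6⟩ | h3
      · exact .inl ⟨hle.viaBlock h3, ⟨b, h4.mono hS, h5⟩,
          h6.imp (fun h => hle.voted2 h) fun h => hle.nullified h⟩
      · exact .inr (h3.mono hS)
    cases hm with
    | advance b hb hv h6 =>
      intro u h1 h2
      rcases (Nat.lt_succ_iff_lt_or_eq.1 h2) with h2 | rfl
      · exact keep u h1 h2
      · exact .inl ⟨.inl rfl, ⟨b, hb.mono hS, hv⟩, h6⟩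
    | null hc =>
      intro u h1 h2
      rcases (Nat.lt_succ_iff_lt_or_eq.1 h2) with h2 | rfl
      · exact keep u h1 h2
      · exact .inr (hc.mono hS)
    | _ => exact keep

/-- The origin of nullify messages. -/
theorem InSlot.nullified (h : E.InSlot p t s) (hE : E.IsExecution) (hΔ : 0 < P.Δ)
    (hp : p ∈ E.correct) {u : ℕ} (hu : u ∈ s.nullified) :
    ∃ t' ≤ t, ∃ c, E.InSlot p t' c ∧ P.TimesOut (E.ctx p t') c ∧ c.view ≤ u ∧
      P.superview u = P.superview c.view ∧ c.view ∈ (E.st p t').nullified := by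
  refine hE.invariant hΔ hp (Q := fun t s => ∀ u ∈ s.nullified, ∃ t' ≤ t, ∃ c, E.InSlot p t' c ∧
    P.TimesOut (E.ctx p t') c ∧ c.view ≤ u ∧
      P.superview u = P.superview c.view ∧ c.view ∈ (E.st p t').nullified) ?_ ?_ ?_ h u hu
  · intro u hu
    exact absurd hu (by simp [Params.init])
  · intro t ht ih u hu
    obtain ⟨t', h1, h2⟩ := ih u hu
    exact ⟨t', by omega, h2⟩
  · intro t s s' hs hs' hm ih
    cases hm with
    | timeout h1 =>
      rintro u (hu | ⟨h2, h3⟩)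
      · exact ih u hu
      · exact ⟨t, le_rfl, s, hs, h1, h2, h3, hs'.le.nullified (.inr ⟨le_rfl, rfl⟩)⟩
    | _ => exact ih

theorem InSlot.nullified_of_out (h : E.InSlot p t s) (hE : E.IsExecution) (hΔ : 0 < P.Δ)
    (hp : p ∈ E.correct) {u : ℕ} {r i : Fin P.n} (hm : (r, .nullify u i) ∈ s.out) :
    i = p ∧ u ∈ s.nullified := by
  refine hE.invariant hΔ hp (Q := fun t s => ∀ r u i, (r, Msg.nullify u i) ∈ s.out →
    i = p ∧ u ∈ s.nullified) ?_ ?_ ?_ h r u i hm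
  · intro r u i hu
    exact absurd hu (by simp [Params.init])
  · intro t ht ih r u i hu
    exact absurd hu (by simp [Params.tick])
  · intro t s s' hs hs' hm ih r u i hu
    cases hm with
    | certs =>
      rcases hu with hu | ⟨hu, _⟩
      · exact ih r u i hu
      · cases hu
    | propose v b C k =>
      rcases hu with hu | ⟨_, hu⟩
      · exact ih r u i hu
      · simp at hu
    | vote1 b c π =>
      rcases hu with (hu | hu) | ⟨_, hu⟩
      · exact ih r u i hu
      · cases hu
      · cases hu
    | vote2 b =>
      rcases hu with hu | hu
      · exact ih r u i hu
      · cases hu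
    | advance b => exact ih r u i hu
    | timeout h1 =>
      rcases hu with hu | ⟨v, h2, h3, h4⟩
      · exact (ih r u i hu).imp_right .inl
      · simp only [toAll, Set.mem_ofPred_eq, Msg.nullify.injEq] at h4
        obtain ⟨rfl, rfl⟩ := h4
        exact ⟨rfl, .inr ⟨h2, h3⟩⟩
    | null => exact ih r u i hu

/-- A correct processor which sends its own fragment to others sends it to itself, too. -/
theorem InSlot.frag_self (h : E.InSlot p t s) (hE : E.IsExecution) (hΔ : 0 < P.Δ)
    (hp : p ∈ E.correct) {r : Fin P.n} (hr : r ≠ p) {b : Block Hash} {c : Bits} {π : List Hash}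
    (hm : (r, .frag b p c π) ∈ s.out) : (p, .frag b p c π) ∈ s.out := by
  refine hE.invariant hΔ hp (Q := fun t s => ∀ r b c π, r ≠ p → (r, Msg.frag b p c π) ∈ s.out →
    (p, .frag b p c π) ∈ s.out) ?_ ?_ ?_ h r b c π hr hm
  · intro r b c π hr hu
    exact absurd hu (by simp [Params.init])
  · intro t ht ih r b c π hr hu
    exact absurd hu (by simp [Params.tick])
  · intro t s s' hs hs' hm ih r b c π hr hu
    cases hm with
    | certs =>
      rcases hu with hu | ⟨hu, _⟩
      · exact .inl (ih r b c π hr hu)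
      · cases hu
    | propose v b C k =>
      rcases hu with hu | ⟨_, hu⟩
      · exact .inl (ih r _ c π hr hu)
      -- A proposal sends the fragment at `j` to `p_j` only, so it sends nobody else the proposer's
      -- own fragment.
      · simp only [Prod.mk.injEq, Msg.frag.injEq] at hu
        exact absurd (hu.1.symm.trans hu.2.2.1) hr
    | vote1 b c π =>
      rcases hu with (hu | hu) | hu
      · exact .inl (.inl (ih r _ _ _ hr hu))
      · cases hu
      · exact .inr hu
    | vote2 b =>
      rcases hu with hu | hu
      · exact .inl (ih r _ _ _ hr hu)
      · cases hu
    | advance b => exact ih r _ _ _ hr hu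
    | timeout h1 =>
      rcases hu with hu | ⟨v, h2, h3, h4⟩
      · exact .inl (ih r _ _ _ hr hu)
      · cases h4
    | null => exact ih r _ _ _ hr hu

/-- The messages that go with a stage-1 vote. -/
theorem InSlot.voted1 (h : E.InSlot p t s) (hE : E.IsExecution) (hΔ : 0 < P.Δ)
    (hp : p ∈ E.correct) {u : ℕ} (hu : u ∈ s.voted1) :
    ∃ b c π, b.view = u ∧ P.CertFrag b.tag p c π ∧ (∀ r, (r, .vote1 b p) ∈ E.outbox p t s) ∧
      (¬ P.IsLead p u → ∀ r, (r, .frag b p c π) ∈ E.outbox p t s) := by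
  refine hE.invariant hΔ hp (Q := fun t s => ∀ u ∈ s.voted1, ∃ b c π, b.view = u ∧
    P.CertFrag b.tag p c π ∧ (∀ r, (r, .vote1 b p) ∈ E.outbox p t s) ∧
      (¬ P.IsLead p u → ∀ r, (r, .frag b p c π) ∈ E.outbox p t s)) ?_ ?_ ?_ h u hu
  · intro u hu
    exact absurd hu (by simp [Params.init])
  · intro t ht ih u hu
    obtain ⟨b, c, π, h1, h2, h3, h4⟩ := ih u hu
    have := hE.outbox_tick hp ht
    exact ⟨b, c, π, h1, h2, fun r => this (h3 r), fun hl r => this (h4 hl r)⟩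
  · intro t s s' hs hs' hm ih
    have ho := outbox_mono (E := E) (p := p) (t := t) hm.le.out
    have keep : ∀ u ∈ s.voted1, ∃ b c π, b.view = u ∧
        P.CertFrag b.tag p c π ∧ (∀ r, (r, .vote1 b p) ∈ E.outbox p t s') ∧
        (¬ P.IsLead p u → ∀ r, (r, .frag b p c π) ∈ E.outbox p t s') := by
      intro u hu
      obtain ⟨b, c, π, h1, h2, h3, h4⟩ := ih u hu
      exact ⟨b, c, π, h1, h2, fun r => ho (h3 r), fun hl r => ho (h4 hl r)⟩
    cases hm with
    | vote1 b c π hv =>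
      rintro u (rfl | hu)
      · exact ⟨b, c, π, hv.2.2.1, hv.2.2.2.1, fun r => .inl (.inl (.inr rfl)),
          fun hl r => .inl (.inr ⟨hl, rfl⟩)⟩
      · exact keep u hu
    | _ => exact keep

/-- The messages that go with a stage-2 vote. -/
theorem InSlot.voted2 (h : E.InSlot p t s) (hE : E.IsExecution) (hΔ : 0 < P.Δ)
    (hp : p ∈ E.correct) {u : ℕ} (hu : u ∈ s.voted2) :
    ∃ b, b.view = u ∧ ∀ r, (r, .vote2 b p) ∈ E.outbox p t s := by
  refine hE.invariant hΔ hp (Q := fun t s => ∀ u ∈ s.voted2, ∃ b, b.view = u ∧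
    ∀ r, (r, .vote2 b p) ∈ E.outbox p t s) ?_ ?_ ?_ h u hu
  · intro u hu
    exact absurd hu (by simp [Params.init])
  · intro t ht ih u hu
    obtain ⟨b, h1, h2⟩ := ih u hu
    exact ⟨b, h1, fun r => hE.outbox_tick hp ht (h2 r)⟩
  · intro t s s' hs hs' hm ih
    have ho := outbox_mono (E := E) (p := p) (t := t) hm.le.out
    have keep : ∀ u ∈ s.voted2, ∃ b, b.view = u ∧ ∀ r, (r, .vote2 b p) ∈ E.outbox p t s' := by
      intro u hu
      obtain ⟨b, h1, h2⟩ := ih u hu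
      exact ⟨b, h1, fun r => ho (h2 r)⟩
    cases hm with
    | vote2 b hb hv =>
      rintro u (rfl | hu)
      · exact ⟨b, hv, fun r => .inl (.inr rfl)⟩
      · exact keep u hu
    | _ => exact keep

/-- A correct processor proposes at most one block for each view. -/
theorem InSlot.proposed_inj (h : E.InSlot p t s) (hE : E.IsExecution) (hΔ : 0 < P.Δ)
    (hp : p ∈ E.correct) : Set.InjOn Block.view s.proposed := by
  refine hE.invariant hΔ hp (Q := fun t s => Set.InjOn Block.view s.proposed) ?_ ?_ ?_ h
  · simp [Params.init]
  · intro t ht ih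
    exact ih
  · intro t s s' hs hs' hm ih
    cases hm with
    | propose v b C k ht =>
      -- The new block is either the first of its superview or lies one view beyond all earlier
      -- proposals there.
      have hne : ∀ b' ∈ s.proposed, b'.view ≠ v := by
        intro b' hb' hv
        rcases ht with ⟨_, ⟨hf, rfl, _⟩ | ⟨_, _, _, h1, h2, rfl, h3⟩⟩
        · exact hf.2 b' hb' (by rw [hv])
        · have := h2 b' hb' (by rw [hv, h3])
          omega
      rw [Set.injOn_insert fun hc => hne _ hc rfl]
      refine ⟨ih, ?_⟩
      rintro ⟨b', hb', hv⟩
      exact hne b' hb' hv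
    | _ => exact ih

/-- Format and dissemination of the blocks proposed by a correct processor. -/
theorem InSlot.proposed (h : E.InSlot p t s) (hE : E.IsExecution) (hΔ : 0 < P.Δ)
    (hp : p ∈ E.correct) {b : Block Hash} (hb : b ∈ s.proposed) :
    P.IsBlock b ∧ P.IsLead p b.view ∧ (P.Initial b.view → P.n = b.tag.k + P.f + 1) ∧
      ∃ C, b.tag = P.tag C b.tag.k ∧ ∀ j, (j, .frag b j (P.code.enc b.tag.k C j)
        (merklePath P.H P.tree (P.frags C b.tag.k) j)) ∈ E.outbox p t s := by
  refine hE.invariant hΔ hp (Q := fun t s => ∀ b ∈ s.proposed,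
    P.IsBlock b ∧ P.IsLead p b.view ∧ (P.Initial b.view → P.n = b.tag.k + P.f + 1) ∧
      ∃ C, b.tag = P.tag C b.tag.k ∧ ∀ j, (j, .frag b j (P.code.enc b.tag.k C j)
        (merklePath P.H P.tree (P.frags C b.tag.k) j)) ∈ E.outbox p t s) ?_ ?_ ?_ h b hb
  · intro b hb
    exact absurd hb (by simp [Params.init])
  · intro t ht ih b hb
    obtain ⟨h1, h2, h3, C, h4, h5⟩ := ih b hb
    exact ⟨h1, h2, h3, C, h4, fun j => hE.outbox_tick hp ht (h5 j)⟩
  · intro t s s' hs hs' hm ih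
    have ho := outbox_mono (E := E) (p := p) (t := t) hm.le.out
    have keep : ∀ b ∈ s.proposed,
        P.IsBlock b ∧ P.IsLead p b.view ∧ (P.Initial b.view → P.n = b.tag.k + P.f + 1) ∧
        ∃ C, b.tag = P.tag C b.tag.k ∧ ∀ j, (j, .frag b j (P.code.enc b.tag.k C j)
          (merklePath P.H P.tree (P.frags C b.tag.k) j)) ∈ E.outbox p t s' := by
      intro b hb
      obtain ⟨h1, h2, h3, C, h4, h5⟩ := ih b hb
      exact ⟨h1, h2, h3, C, h4, fun j => ho (h5 j)⟩
    cases hm with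
    | propose v b C k ht hk1 hk2 hk3 =>
      rintro b' (rfl | hb')
      · have hv : 1 ≤ v ∧ P.IsLead p v := by
          rcases ht with ⟨hl, ⟨_, rfl, _⟩ | ⟨_, _, _, h1, h2, rfl, h3⟩⟩
          · exact ⟨hs.view_pos hE hΔ hp, hl⟩
          · exact ⟨by omega, hl.congr h3.symm⟩
        exact ⟨⟨hv.1, hk1, hk2, rfl⟩, hv.2, hk3, C, rfl, fun j => .inl (.inr ⟨j, rfl⟩)⟩
      · exact keep b' hb'
    | _ => exact keep

/-- The parents of the blocks proposed by a correct processor. -/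
theorem InSlot.proposed_parent (h : E.InSlot p t s) (hE : E.IsExecution) (hΔ : 0 < P.Δ)
    (hp : p ∈ E.correct) {b : Block Hash} (hb : b ∈ s.proposed) :
    (P.Initial b.view ∧ ∃ b', P.IsParent b' b ∧ P.Blocks ((E.ctx p t).S s) b' ∧
      b'.view < b.view ∧ ∀ u, b'.view < u → u < b.view → P.Certs ((E.ctx p t).S s) (.ncert u)) ∨
    (¬ P.Initial b.view ∧ ∃ b' ∈ s.proposed, P.IsParent b' b ∧ b'.view + 1 = b.view) := by
  refine hE.invariant hΔ hp (Q := fun t s => ∀ b ∈ s.proposed,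
    (P.Initial b.view ∧ ∃ b', P.IsParent b' b ∧ P.Blocks ((E.ctx p t).S s) b' ∧
      b'.view < b.view ∧ ∀ u, b'.view < u → u < b.view → P.Certs ((E.ctx p t).S s) (.ncert u)) ∨
    (¬ P.Initial b.view ∧ ∃ b' ∈ s.proposed, P.IsParent b' b ∧ b'.view + 1 = b.view)) ?_ ?_ ?_
    h b hb
  · intro b hb
    exact absurd hb (by simp [Params.init])
  · intro t ht ih b hb
    have := hE.S_tick hp ht
    rcases ih b hb with ⟨h1, b', h2, h3, h4, h5⟩ | h1
    · exact .inl ⟨h1, b', h2, h3.mono this, h4, fun u hu hu' => (h5 u hu hu').mono this⟩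
    · exact .inr h1
  · intro t s s' hs hs' hm ih
    have hS := Ctx.S_mono (E.ctx p t) hm.le.out
    have hle := hm.le
    have keep : ∀ b ∈ s.proposed,
        (P.Initial b.view ∧ ∃ b', P.IsParent b' b ∧ P.Blocks ((E.ctx p t).S s') b' ∧
          b'.view < b.view ∧
          ∀ u, b'.view < u → u < b.view → P.Certs ((E.ctx p t).S s') (.ncert u)) ∨
        (¬ P.Initial b.view ∧ ∃ b' ∈ s'.proposed, P.IsParent b' b ∧ b'.view + 1 = b.view) := by
      intro b hb
      rcases ih b hb with ⟨h1, b', h2, h3, h4, h5⟩ | ⟨h1, b', h2, h3⟩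
      · exact .inl ⟨h1, b', h2, h3.mono hS, h4, fun u hu hu' => (h5 u hu hu').mono hS⟩
      · exact .inr ⟨h1, b', hle.proposed h2, h3⟩
    cases hm with
    | propose v b C k ht =>
      rintro b' (rfl | hb')
      · rcases ht with ⟨_, ⟨hf, rfl, rfl⟩ | ⟨_, _, h0, h1, _, rfl, h3⟩⟩
        · obtain ⟨h1, h2, h3⟩ := hs.par hE hΔ hp
          exact .inl ⟨hf.1, s.par, rfl, h1.mono hS, h2, fun u hu hu' => (h3 u hu hu').mono hS⟩
        · refine .inr ⟨?_, b, .inr h0, rfl, rfl⟩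
          exact P.not_initial_succ (hs.proposed hE hΔ hp h0).1.1 (h3.trans h1.symm)
      · exact keep b' hb'
    | _ => exact keep

end Run

namespace Run

variable {Hash : Type u} {P : Params Hash}

/-- Standing assumptions on an execution, `δ` being a bound for message delays after GST. -/
structure Standing (E : Run P) (δ : ℕ) : Prop where
  hn : 4 * P.f + 1 ≤ P.n
  hn2 : 2 ≤ P.n
  hΔ : 0 < P.Δ
  hH : Function.Injective P.H
  htree : P.tree.size = P.n
  hE : E.IsExecution
  hδ0 : 0 < δ
  hδ : E.DelayBound δ
  hδΔ : δ ≤ P.Δ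

/-! ### Unforgeability for all processors -/

/-- If the leader who signs `b` is correct, then it has proposed `b` by timeslot `t`. -/
def BlockProposed (E : Run P) (b : Block Hash) (t : ℕ) : Prop :=
  1 ≤ b.view → ∀ p ∈ E.correct, P.IsLead p b.view → E.start p ≤ t ∧ b ∈ (E.st p t).proposed

/-- The blocks in a message have been proposed and the nullify messages in it have been sent, as
far as correct processors are concerned. -/
def Genuine (E : Run P) (t : ℕ) : Msg Hash P.n → Prop
  | .frag b _ _ _ => E.BlockProposed b t
  | .vote1 b _ => E.BlockProposed b t
  | .vote2 b _ => E.BlockProposed b t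
  | .mcert b => E.BlockProposed b t
  | .cert b => E.BlockProposed b t
  | .nullify v i => i ∈ E.correct → E.start i ≤ t ∧ v ∈ (E.st i t).nullified
  | .ncert v => ∃ i ∈ E.correct, E.start i ≤ t ∧ v ∈ (E.st i t).nullified

variable {E : Run P} {δ : ℕ}

theorem BlockProposed.mono (A : E.Standing δ) {b : Block Hash} {t t' : ℕ} (htt : t ≤ t')
    (h : E.BlockProposed b t) : E.BlockProposed b t' := fun hb p hp hl =>
  ⟨(h hb p hp hl).1.trans htt,
    (A.hE.grows A.hΔ hp (h hb p hp hl).1 htt).proposed (h hb p hp hl).2⟩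

theorem Genuine.mono (A : E.Standing δ) {m : Msg Hash P.n} {t t' : ℕ} (htt : t ≤ t')
    (h : E.Genuine t m) : E.Genuine t' m := by
  cases m with
  | nullify v i =>
    exact fun hi => ⟨(h hi).1.trans htt, (A.hE.grows A.hΔ hi (h hi).1 htt).nullified (h hi).2⟩
  | ncert v =>
    obtain ⟨i, hi, h1, h2⟩ := h
    exact ⟨i, hi, h1.trans htt, (A.hE.grows A.hΔ hi h1 htt).nullified h2⟩
  | _ => exact BlockProposed.mono A htt h

theorem BlockBacked.blockProposed (A : E.Standing δ) {b : Block Hash} {t : ℕ}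
    (h : E.BlockBacked b t) : E.BlockProposed b t := by
  intro hb p hp hl
  obtain ⟨s, hs, h1, h2, _⟩ := h hb p hp hl
  exact ⟨h1.trans hs, (A.hE.grows A.hΔ hp h1 hs).proposed h2⟩

theorem Standing.le_start_of_sent (A : E.Standing δ) {p : Fin P.n} (hp : p ∈ E.correct) {t : ℕ}
    {y : Fin P.n × Msg Hash P.n} (hy : y ∈ E.sent p t) : E.start p ≤ t := by
  by_contra hc
  rw [A.hE.sent_before p hp t (by omega)] at hy
  exact hy

theorem Standing.nullified_of_sent (A : E.Standing δ) {p : Fin P.n} (hp : p ∈ E.correct) {t : ℕ}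
    {v : ℕ} {q : Fin P.n} (h : (q, .nullify v p) ∈ E.sent p t) :
    E.start p ≤ t ∧ v ∈ (E.st p t).nullified := by
  have hs := A.le_start_of_sent hp h
  rw [A.hE.sent_eq p hp t hs] at h
  exact ⟨hs, ((A.hE.inSlot_st A.hΔ hp hs).nullified_of_out A.hE A.hΔ hp h).2⟩

theorem Standing.exists_correct (A : E.Standing δ) {X : Finset (Fin P.n)}
    (hX : P.f + 1 ≤ X.card) : ∃ i ∈ X, i ∈ E.correct := by
  by_contra! hc
  have : X ⊆ E.correctᶜ := fun i hi => Finset.mem_compl.2 (hc i hi)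
  have := Finset.card_le_card this
  have := A.hE.faulty_le
  omega

theorem Backed.genuine (A : E.Standing δ) {m : Msg Hash P.n} {t : ℕ} (h : E.Backed t m) :
    E.Genuine t m := by
  have key : ∀ v i, i ∈ E.correct → E.SentBy i (.nullify v i) t →
      E.start i ≤ t ∧ v ∈ (E.st i t).nullified := by
    rintro v i hi ⟨s, hs, q, hq⟩
    have := A.nullified_of_sent hi hq
    exact ⟨this.1.trans hs, (A.hE.grows A.hΔ hi this.1 hs).nullified this.2⟩
  cases m with
  | frag => exact BlockBacked.blockProposed A h
  | vote1 => exact BlockBacked.blockProposed A h.1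
  | vote2 => exact BlockBacked.blockProposed A h.1
  | mcert => exact BlockBacked.blockProposed A h.1
  | cert => exact BlockBacked.blockProposed A h.1
  | nullify v i => exact fun hi => key v i hi (h hi)
  | ncert v =>
    obtain ⟨X, hX, hX'⟩ := h
    obtain ⟨i, hi, hi'⟩ := A.exists_correct (X := X) (by omega)
    exact ⟨i, hi', key v i hi' (hX' i hi hi')⟩

section

variable {S : Mail Hash P.n} {t : ℕ}

/-- A locally formed certificate contains at least one vote, as f+1 and n-f are positive, and any
vote vouches for its block. Among 2f+1 nullifying signers one is correct. -/
theorem genuine_of_certs (A : E.Standing δ) (hS : ∀ y ∈ S, E.Genuine t y.2) {m : Msg Hash P.n}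
    (hm : P.Certs S m) : E.Genuine t m := by
  have hn := A.hn
  cases hm with
  | mcert q b h => exact hS _ h
  | cert q b h => exact hS _ h
  | ncert q v h => exact hS _ h
  | formM b h =>
    obtain ⟨i, q, hq⟩ := Set.nonempty_of_ncard_ne_zero (by omega :
      {i | ∃ q, (q, Msg.vote2 b i) ∈ S}.ncard ≠ 0)
    exact hS _ hq
  | form b h =>
    obtain ⟨i, q, hq⟩ := Set.nonempty_of_ncard_ne_zero (by omega :
      {i | ∃ q, (q, Msg.vote2 b i) ∈ S}.ncard ≠ 0)
    exact hS _ hq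
  | formN v h =>
    rw [Set.ncard_eq_toFinset_card _ (Set.toFinite _)] at h
    obtain ⟨i, hi, hi'⟩ := A.exists_correct (le_trans (by omega) h)
    obtain ⟨q, hq⟩ := (Set.Finite.mem_toFinset _).1 hi
    exact ⟨i, hi', hS _ hq hi'⟩

theorem blockProposed_of_blocks (A : E.Standing δ) (hS : ∀ y ∈ S, E.Genuine t y.2)
    {b : Block Hash} (hb : P.Blocks S b) : E.BlockProposed b t := fun hv =>
  genuine_of_certs A hS (hb.mcert hv) hv

theorem blockProposed_of_blocksStar (A : E.Standing δ) (hS : ∀ y ∈ S, E.Genuine t y.2)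
    {b : Block Hash} (hb : P.BlocksStar S b) : E.BlockProposed b t := by
  rcases hb with rfl | ⟨h1, _, ⟨I, c, π, hI, hf, _⟩, _⟩
  · intro hv
    simp [Params.genesis] at hv
  · have := h1.k_pos A.hn A.hn2
    obtain ⟨j, hj⟩ := Finset.card_pos.1 (by omega : 0 < I.card)
    exact hS _ (hf j hj).1

end

/-- The inductive step in time for correct senders. Whatever they pass on was received from others,
hence sent strictly earlier, or was produced by themselves, which the invariant along the timeslot
covers. -/
theorem Standing.genuine_out (A : E.Standing δ) {p : Fin P.n} (hp : p ∈ E.correct) {t : ℕ}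
    {s : LState Hash P.n} (h : E.InSlot p t s)
    (ih : ∀ t' < t, ∀ q, ∀ y ∈ E.sent q t', E.Genuine t' y.2) :
    ∀ y ∈ s.out, E.Genuine t y.2 := by
  refine A.hE.invariant A.hΔ hp (Q := fun t s =>
    (∀ t' < t, ∀ q, ∀ y ∈ E.sent q t', E.Genuine t' y.2) → ∀ y ∈ s.out, E.Genuine t y.2)
    ?_ ?_ ?_ h ih
  · intro _ y hy
    exact absurd hy (by simp [Params.init])
  · intro t _ _ _ y hy
    exact absurd hy (by simp [Params.tick])
  · intro t s s' hs hs' hm ih1 ih2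
    have ho := ih1 ih2
    have hS : ∀ y ∈ (E.ctx p t).S s, E.Genuine t y.2 := by
      rintro y ((⟨h1, s', h2, h3⟩ | ⟨_, s', h2, h3⟩) | ⟨hy, _⟩)
      · have := A.hE.lt_arr y.1 p s' y.2 h1 h2
        exact (ih2 s' (by omega) _ _ h2).mono A (by omega)
      · exact (ih2 s' h2 _ _ h3).mono A h2.le
      · exact ho y hy
    cases hm with
    | certs =>
      rintro y (hy | ⟨hy, _⟩)
      · exact ho y hy
      · exact genuine_of_certs A hS hy
    | propose v b C k ht hk1 hk2 hk3 =>
      rintro y (hy | ⟨j, rfl⟩)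
      · exact ho y hy
      -- The leader of the block's view is unique, so it is the proposer itself.
      · intro hb q hq hl
        have hmem : (⟨v, P.tag C k, some (P.H (.block b))⟩ : Block Hash) ∈ (E.st p t).proposed :=
          hs'.le.proposed (.inl rfl)
        have hst := A.hE.inSlot_st A.hΔ hp hs.start_le
        obtain rfl := (hst.proposed A.hE A.hΔ hp hmem).2.1.unique hl
        exact ⟨hs.start_le, hmem⟩
    | vote1 b c π hv =>
      obtain ⟨⟨q, hq⟩, _⟩ := hv
      rintro y ((hy | hy) | ⟨_, hy⟩)
      · exact ho y hy
      · rw [show y.2 = _ from hy]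
        exact hS _ hq
      · rw [show y.2 = _ from hy]
        exact hS _ hq
    | vote2 b hb hv =>
      rintro y (hy | hy)
      · exact ho y hy
      · rw [show y.2 = _ from hy]
        rcases hb with hb | hb
        · exact blockProposed_of_blocksStar A hS hb
        · exact blockProposed_of_blocks A hS hb
    | advance b => exact ho
    | timeout h1 =>
      rintro y (hy | ⟨v, h2, h3, hy⟩)
      · exact ho y hy
      · rw [show y.2 = _ from hy]
        exact fun _ => ⟨hs.start_le, hs'.le.nullified (.inr ⟨h2, h3⟩)⟩
    | null => exact ho

/-- Strong induction on time, which works because message delays are positive. For faulty senders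
the claim comes from `unforgeable`. -/
theorem Standing.genuine_sent (A : E.Standing δ) {t : ℕ} {q : Fin P.n}
    {y : Fin P.n × Msg Hash P.n} (hy : y ∈ E.sent q t) : E.Genuine t y.2 := by
  induction t using Nat.strong_induction_on generalizing q y with
  | _ t ih =>
    by_cases hq : q ∈ E.correct
    · have hs := A.le_start_of_sent hq hy
      rw [A.hE.sent_eq q hq t hs] at hy
      exact A.genuine_out hq (A.hE.inSlot_st A.hΔ hq hs) (fun t' h _ _ h' => ih t' h h') y hy
    · exact Backed.genuine A (A.hE.unforgeable q hq t y hy)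

theorem Standing.genuine_received (A : E.Standing δ) {t : ℕ} {q : Fin P.n} :
    ∀ y ∈ E.received q t, E.Genuine t y.2 := by
  rintro y (⟨h1, s, h2, h3⟩ | ⟨_, s, h2, h3⟩)
  · have := A.hE.lt_arr y.1 q s y.2 h1 h2
    exact (A.genuine_sent h2).mono A (by omega)
  · exact (A.genuine_sent h3).mono A h2

/-- An N-certificate requires that some correct processor has nullified the view. -/
theorem Standing.nullified_of_ncert (A : E.Standing δ) {t : ℕ} {q : Fin P.n} {u : ℕ}
    (h : P.Certs (E.received q t) (.ncert u)) :
    ∃ i ∈ E.correct, E.start i ≤ t ∧ u ∈ (E.st i t).nullified :=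
  genuine_of_certs A A.genuine_received h

theorem Standing.blockProposed (A : E.Standing δ) {t : ℕ} {q : Fin P.n} {b : Block Hash}
    (h : P.Blocks (E.received q t) b) : E.BlockProposed b t :=
  blockProposed_of_blocks A A.genuine_received h

/-- A correct leader has only one block for each of its views. -/
theorem Standing.eq_of_blockProposed (A : E.Standing δ) {p : Fin P.n} (hp : p ∈ E.correct)
    {b b' : Block Hash} {t t' : ℕ} (hl : P.IsLead p b.view) (ht : E.start p ≤ t)
    (hb : b ∈ (E.st p t).proposed) (hb' : E.BlockProposed b' t') (hv : b'.view = b.view) :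
    b' = b := by
  have h1 := ((A.hE.inSlot_st A.hΔ hp ht).proposed A.hE A.hΔ hp hb).1.1
  obtain ⟨h2, h3⟩ := hb' (by omega) p hp (hv ▸ hl)
  have hm : E.start p ≤ max t t' := le_trans ht (le_max_left _ _)
  exact (A.hE.inSlot_st A.hΔ hp hm).proposed_inj A.hE A.hΔ hp
    ((A.hE.grows A.hΔ hp h2 (le_max_right _ _)).proposed h3)
    ((A.hE.grows A.hΔ hp ht (le_max_left _ _)).proposed hb) hv

/-! ### Message delivery -/

theorem Standing.mem_inbox (A : E.Standing δ) {r j : Fin P.n} {m : Msg Hash P.n} {s D : ℕ}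
    (h : (j, m) ∈ E.sent r s) (hD : max E.GST s + δ ≤ D) : (r, m) ∈ (E.ctx j D).inbox := by
  by_cases hr : r = j
  · subst hr
    -- Own messages belong to the inbox from the next timeslot on, which is in time because `δ` is
    -- positive.
    have := A.hδ0
    exact .inr ⟨rfl, s, by omega, h⟩
  · exact .inl ⟨hr, s, h, (A.hδ r j s m hr h).trans hD⟩

theorem Standing.received_eq_empty (A : E.Standing δ) {p : Fin P.n} (hp : p ∈ E.correct) {t : ℕ}
    (ht : t < E.start p) : E.received p t = ∅ := by
  rw [Set.eq_empty_iff_forall_notMem]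
  rintro y (⟨h1, s, h2, h3⟩ | ⟨_, s, h2, h3⟩)
  · have := A.hE.start_le_arr y.1 p hp s y.2 h1 h2
    omega
  · have := A.le_start_of_sent hp h3
    omega

theorem Standing.not_certs_empty (A : E.Standing δ) {m : Msg Hash P.n}
    (h : P.Certs (∅ : Mail Hash P.n) m) : False := by
  have := A.hn
  cases h with
  | formM b h => simp at h
  | form b h => simp at h; omega
  | formN v h => simp at h
  | _ => contradiction

/-- Correct processors disseminate the certificates which they receive. -/
theorem Standing.disseminate (A : E.Standing δ) {p : Fin P.n} (hp : p ∈ E.correct) {t : ℕ}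
    {m : Msg Hash P.n} (h : P.Certs (E.received p t) m) :
    ∃ s ≤ t, ∀ q, (q, m) ∈ E.sent p s := by
  classical
  -- At the first timeslot at which the certificate is held it is not yet in `known`, so the settled
  -- state at the end of that timeslot has sent it to everybody.
  have hex : ∃ s, P.Certs (E.received p s) m := ⟨t, h⟩
  have hs := Nat.find_spec hex
  have hst : E.start p ≤ Nat.find hex := by
    by_contra hc
    rw [A.received_eq_empty hp (by omega)] at hs
    exact A.not_certs_empty hs
  refine ⟨Nat.find hex, Nat.find_min' hex h, fun q => ?_⟩
  rw [A.hE.sent_eq p hp _ hst]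
  refine (A.hE.settled hp hst).certs m ?_ ?_ q
  · rwa [A.hE.S_st hp hst]
  · rintro ⟨s, h1, h2⟩
    exact Nat.find_min hex h1 h2

/-- The recipient may be faulty: the inbox only records deliveries. This matters later, since faulty
processors may count among those that disseminate fragments. -/
theorem Standing.certs_transfer (A : E.Standing δ) {p : Fin P.n} (hp : p ∈ E.correct) {t D : ℕ}
    {m : Msg Hash P.n} (h : P.Certs (E.received p t) m) (hD : max E.GST t + δ ≤ D)
    (q : Fin P.n) : P.Certs (E.ctx q D).inbox m := by
  obtain ⟨s, hs, hs'⟩ := A.disseminate hp h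
  have := A.mem_inbox (hs' q) (D := D) (by omega)
  cases h with
  | mcert => exact .mcert _ _ this
  | cert => exact .cert _ _ this
  | ncert => exact .ncert _ _ this
  | formM => exact .mcert _ _ this
  | form => exact .cert _ _ this
  | formN => exact .ncert _ _ this

theorem Standing.blocks_transfer (A : E.Standing δ) {p : Fin P.n} (hp : p ∈ E.correct) {t D : ℕ}
    {b : Block Hash} (h : P.Blocks (E.received p t) b) (hD : max E.GST t + δ ≤ D)
    (q : Fin P.n) : P.Blocks (E.ctx q D).inbox b :=
  h.of_certs fun _ hc => A.certs_transfer hp hc hD q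

/-! ### States at the ends of timeslots -/

theorem Standing.view_pos (A : E.Standing δ) {p : Fin P.n} (hp : p ∈ E.correct) {t : ℕ}
    (ht : E.start p ≤ t) : 1 ≤ (E.st p t).view :=
  (A.hE.inSlot_st A.hΔ hp ht).view_pos A.hE A.hΔ hp

theorem Standing.left (A : E.Standing δ) {p : Fin P.n} (hp : p ∈ E.correct) {t : ℕ}
    (ht : E.start p ≤ t) {u : ℕ} (hu : 1 ≤ u) (hut : u < (E.st p t).view) :
    (u + 1 ∈ (E.st p t).viaBlock ∧ (∃ b, P.Blocks (E.received p t) b ∧ b.view = u) ∧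
      (u ∈ (E.st p t).voted2 ∨ u ∈ (E.st p t).nullified)) ∨
      P.Certs (E.received p t) (.ncert u) := by
  have := (A.hE.inSlot_st A.hΔ hp ht).left A.hE A.hΔ hp hu hut
  rwa [A.hE.S_st hp ht] at this

theorem Standing.reached_transfer (A : E.Standing δ) {r : Fin P.n} (hr : r ∈ E.correct)
    {t D w : ℕ} (ht : E.start r ≤ t) (hw : w ≤ (E.st r t).view) (hD : max E.GST t + δ ≤ D)
    (q : Fin P.n) : P.Reached (E.ctx q D).inbox w := by
  intro u hu huw
  rcases A.left hr ht hu (huw.trans_le hw) with ⟨_, ⟨b, h1, h2⟩, _⟩ | h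
  · exact .inr ⟨b, A.blocks_transfer hr h1 hD q, h2⟩
  · exact .inl (A.certs_transfer hr h hD q)

/-- A settled state cannot be in a view that the received messages allow to be left. -/
theorem Standing.le_view_of_reached (A : E.Standing δ) {q : Fin P.n} (hq : q ∈ E.correct)
    {D w : ℕ} (hD : E.start q ≤ D) (h : P.Reached (E.received q D) w) :
    w ≤ (E.st q D).view := by
  by_contra hc
  have hs := A.hE.settled hq hD
  have hb := hs.blocks
  have hc' := hs.ncert
  rw [A.hE.S_st hq hD] at hb hc'
  rcases h _ (A.view_pos hq hD) (by omega) with h | ⟨b, h1, h2⟩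
  · exact hc' h
  · exact hb b h1 h2

/-- When a correct processor has reached a view, then the others do so soon after. -/
theorem Standing.catch_up (A : E.Standing δ) {r q : Fin P.n} (hr : r ∈ E.correct)
    (hq : q ∈ E.correct) {t D w : ℕ} (ht : E.start r ≤ t) (hw : w ≤ (E.st r t).view)
    (hD : max E.GST t + δ ≤ D) : w ≤ (E.st q D).view := by
  have := A.hE.start_le q hq
  exact A.le_view_of_reached hq (by omega)
    ((A.reached_transfer hr ht hw hD q).mono (E.inbox_subset_received q D))

theorem Standing.card_correct (A : E.Standing δ) : P.n ≤ E.correct.card + P.f := by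
  have h1 := A.hE.faulty_le
  have h2 := Finset.card_add_card_compl E.correct
  rw [Fintype.card_fin] at h2
  omega

theorem Standing.le_ncard (A : E.Standing δ) {S : Mail Hash P.n} {g : Fin P.n → Msg Hash P.n}
    (h : ∀ i ∈ E.correct, (i, g i) ∈ S) : P.n ≤ {i | ∃ q, (q, g i) ∈ S}.ncard + P.f := by
  have h1 : (E.correct : Set (Fin P.n)) ⊆ {i | ∃ q, (q, g i) ∈ S} := fun i hi => ⟨i, h i hi⟩
  have h2 := Set.ncard_le_ncard h1 (Set.toFinite _)
  rw [Set.ncard_coe_finset] at h2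
  have := A.card_correct
  omega

/-! ### From spread fragments to finalisation in one view -/

/-- By timeslot `D` all correct processors have reached view `w`, in which the correct leader has
proposed the block `b`, fragments of `b` are votable, and enough fragments will be received by
`D + δ` if all correct processors but the leader have disseminated theirs by `D`. -/
structure Spread (E : Run P) (δ w : ℕ) (b : Block Hash) (D : ℕ) : Prop where
  le : E.GST ≤ D
  leader : ∃ p ∈ E.correct, P.IsLead p w ∧ b ∈ (E.st p D).proposed
  view : b.view = w
  reached : ∀ r ∈ E.correct, w ≤ (E.st r D).view
  votable : ∀ j, ∃ c π, P.Votable (E.ctx j D).inbox j w b c π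
  frags : (∀ r ∈ E.correct, ¬ P.IsLead r w → ∃ c π, P.CertFrag b.tag r c π ∧
      ∀ q, ∃ s ≤ D, (q, .frag b r c π) ∈ E.sent r s) →
    ∃ I : Finset (Fin P.n), I.card = b.tag.k ∧ ∀ q ∈ E.correct, ∀ j ∈ I, ∃ c π,
      (j, .frag b j c π) ∈ (E.ctx q (D + δ)).inbox ∧ P.CertFrag b.tag j c π

namespace Spread

variable {w D : ℕ} {b : Block Hash}

theorem start_le (A : E.Standing δ) (h : E.Spread δ w b D) {r : Fin P.n} (hr : r ∈ E.correct) :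
    E.start r ≤ D := (A.hE.start_le r hr).trans h.le

theorem eq_of_blockProposed (A : E.Standing δ) (h : E.Spread δ w b D) {b' : Block Hash} {t : ℕ}
    (hb : E.BlockProposed b' t) (hv : b'.view = w) : b' = b := by
  obtain ⟨p, hp, hl, hb'⟩ := h.leader
  exact A.eq_of_blockProposed hp (h.view ▸ hl) (h.start_le A hp) hb' hb (hv.trans h.view.symm)

theorem one_le (A : E.Standing δ) (h : E.Spread δ w b D) : 1 ≤ w := by
  obtain ⟨p, hp, hl, hb⟩ := h.leader
  rw [← h.view]
  exact ((A.hE.inSlot_st A.hΔ hp (h.start_le A hp)).proposed A.hE A.hΔ hp hb).1.1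

/-- By `D`, every correct processor has sent a stage-1 vote or has `b` in `blocks`. -/
theorem vote1_or_blocks (A : E.Standing δ) (h : E.Spread δ w b D)
    (hnn : ∀ r ∈ E.correct, w ∉ (E.st r D).nullified) {r : Fin P.n} (hr : r ∈ E.correct) :
    P.Blocks (E.received r D) b ∨
      ((∀ q, ∃ s ≤ D, (q, .vote1 b r) ∈ E.sent r s) ∧ (¬ P.IsLead r w →
        ∃ c π, P.CertFrag b.tag r c π ∧ ∀ q, ∃ s ≤ D, (q, .frag b r c π) ∈ E.sent r s)) := by
  have hst := h.start_le A hr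
  rcases (h.reached r hr).eq_or_lt with hw | hw
  · right
    obtain ⟨c, π, hc⟩ := h.votable r
    have hv := (A.hE.settled hr hst).votable b c π
    rw [← hw] at hv
    -- The vote may have been cast earlier and for an a priori different block; as the leader signed
    -- only one block for the view, it is `b`.
    obtain ⟨b', c', π', h1, h2, h3, h4⟩ := (A.hE.inSlot_st A.hΔ hr hst).voted1 A.hE A.hΔ hr
      (hv (hc.mono (Ctx.inbox_subset_S _ _)))
    simp only [A.hE.mem_outbox_st hr hst] at h3 h4
    obtain rfl : b' = b := by
      obtain ⟨s, _, hs⟩ := h3 r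
      exact h.eq_of_blockProposed A (A.genuine_sent hs) h1
    exact ⟨h3, fun hl => ⟨c', π', h2, h4 hl⟩⟩
  · left
    -- The processor has moved beyond `w`. An N-certificate is excluded by `hnn`, so it left through
    -- a view `w` block, which can only be `b`.
    rcases A.left hr hst (h.one_le A) hw with ⟨_, ⟨b', h1, h2⟩, _⟩ | hc
    · rwa [← h.eq_of_blockProposed A (A.blockProposed h1) h2]
    · obtain ⟨i, hi, _, hi'⟩ := A.nullified_of_ncert hc
      exact absurd hi' (hnn i hi)

/-- If some correct processor has `b` in `blocks` by `D`, the M-certificates it forwards put `b`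
into `blocks` everywhere. Otherwise all correct processors have voted and, apart from the leader,
disseminated their fragments by `D`, and `b` enters `blocks*`. -/
theorem blocksStar_or_blocks (A : E.Standing δ) (h : E.Spread δ w b D)
    (hnn : ∀ r ∈ E.correct, w ∉ (E.st r D).nullified) {q : Fin P.n} (hq : q ∈ E.correct) :
    P.BlocksStar (E.ctx q (D + δ)).inbox b ∨ P.Blocks (E.ctx q (D + δ)).inbox b := by
  have hD := h.le
  by_cases hb : ∃ r ∈ E.correct, P.Blocks (E.received r D) b
  · obtain ⟨r, hr, hb⟩ := hb
    exact .inr (A.blocks_transfer hr hb (by omega) q)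
  · left
    have hv : ∀ r ∈ E.correct, (∀ q, ∃ s ≤ D, (q, Msg.vote1 b r) ∈ E.sent r s) ∧
        (¬ P.IsLead r w → ∃ c π, P.CertFrag b.tag r c π ∧
          ∀ q, ∃ s ≤ D, (q, .frag b r c π) ∈ E.sent r s) := fun r hr =>
      (h.vote1_or_blocks A hnn hr).resolve_left fun hc => hb ⟨r, hr, hc⟩
    have hvot1 := A.le_ncard (S := (E.ctx q (D + δ)).inbox) (g := Msg.vote1 b) fun r hr => by
      obtain ⟨s, hs, hs'⟩ := (hv r hr).1 q
      exact A.mem_inbox hs' (by omega)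
    obtain ⟨I, hI, hf⟩ := h.frags fun r hr => (hv r hr).2
    obtain ⟨p, hp, hl, hbp⟩ := h.leader
    obtain ⟨hblk, _, _, C, hC, _⟩ :=
      (A.hE.inSlot_st A.hΔ hp (h.start_le A hp)).proposed A.hE A.hΔ hp hbp
    have hk := hblk.k_pos A.hn A.hn2
    have hkn := hblk.2.2.1
    choose! c π hcπ using hf q hq
    obtain ⟨c₀, π₀, _, _, _, _, b', hb', hpar, _⟩ := h.votable q
    refine .inr ⟨hblk, ?_, ⟨I, c, π, hI, hcπ, ?_⟩, b',
      hb'.mono (E.inbox_mono q (Nat.le_add_right _ _)), hpar⟩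
    -- The votes of the correct processors number at least n-f, which is at least n - (3/2)f.
    · unfold Params.Notarised1
      omega
    · have := P.decode_ne_none A.hH A.htree C b.tag.k hk (by omega) I hI c π
        fun j hj => hC ▸ (hcπ j hj).2
      rwa [← hC] at this

end Spread

/-- If fragments are spread in time, then no correct processor times out. -/
theorem Standing.not_nullified (A : E.Standing δ) {w D tw : ℕ}
    (hprev : ∀ u, P.firstView w ≤ u → u < w → ∀ q ∈ E.correct, ∀ s, E.start q ≤ s →
      u ∉ (E.st q s).nullified)
    (hfirst : ∀ q ∈ E.correct, ∀ s, E.start q ≤ s → w ≤ (E.st q s).view → tw ≤ s)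
    (hD : P.Initial w ∧ D ≤ tw + 2 * P.Δ ∨ ¬ P.Initial w ∧ D ≤ tw + P.Δ)
    (hspread : (∀ q ∈ E.correct, ∀ s < D, E.start q ≤ s → w ∉ (E.st q s).nullified) →
      ∃ b, E.Spread δ w b D)
    {q : Fin P.n} (hq : q ∈ E.correct) {s : ℕ} (hs : E.start q ≤ s) :
    w ∉ (E.st q s).nullified := by
  classical
  intro hc
  -- Consider the earliest timeslot at which a correct processor has nullified `w`. Before it, the
  -- reasoning that presupposes the absence of nullifications is valid.
  have hex : ∃ s, ∃ q ∈ E.correct, E.start q ≤ s ∧ w ∈ (E.st q s).nullified := ⟨s, q, hq, hs, hc⟩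
  clear hs hc hq
  have hmin : ∀ t < Nat.find hex, ∀ q ∈ E.correct, E.start q ≤ t → w ∉ (E.st q t).nullified :=
    fun t ht q hq h1 h2 => Nat.find_min hex ht ⟨q, hq, h1, h2⟩
  obtain ⟨q, hq, hs, hqw⟩ := Nat.find_spec hex
  obtain ⟨t', ht', c, hcs, hto, hcw, hsv, hcn⟩ :=
    (A.hE.inSlot_st A.hΔ hq hs).nullified A.hE A.hΔ hq hqw
  -- A time-out nullifies all later views of the superview as well, so it may have occurred in a
  -- view before `w`; `hprev` rules this out.
  obtain hcw | hcw := hcw.lt_or_eq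
  · refine hprev c.view ?_ hcw q hq t' hcs.start_le hcn
    rw [P.firstView_eq_of_superview_eq hsv]
    exact P.firstView_le (hcs.view_pos A.hE A.hΔ hq)
  · rw [hcw] at hcn
    have hle : Nat.find hex ≤ t' := Nat.find_min' hex ⟨q, hq, hcs.start_le, hcn⟩
    obtain ⟨t₁, h1, h2, h3⟩ := hcs.timer A.hE A.hΔ hq
    have htw := hfirst q hq t₁ h1 (hcw ▸ h3)
    have hδΔ := A.hδΔ
    have hδ0 := A.hδ0
    have hr := hto.ready
    simp only [Params.TimeoutReady, hcw] at hr
    -- Even the shorter time-out, 2Δ in an initial view and Δ otherwise, does not expire before `D`.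
    have hDt : D ≤ t' := by
      rcases hD with ⟨hi, hD⟩ | ⟨hi, hD⟩ <;> simp [hi] at hr <;> omega
    obtain ⟨b, hb⟩ := hspread fun q hq s hs => hmin s (by omega) q hq
    have hv1 : w ∈ c.voted1 := by
      obtain ⟨x, π, hv⟩ := hb.votable q
      have := hto.voted1 b x π
      rw [hcw] at this
      exact this (hv.mono (E.inbox_mono q hDt))
    -- As the stage-1 vote has been sent, only the longer time-out is possible. It allows a further
    -- Δ, and `δ ≤ Δ`.
    have hDt' : D + δ ≤ t' := by
      rcases hD with ⟨hi, hD⟩ | ⟨hi, hD⟩ <;> simp [hi, hv1] at hr <;> omega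
    have hv2 : w ∉ c.voted2 := by tauto
    rcases hb.blocksStar_or_blocks A (fun r hr => hmin D (by omega) r hr (hb.start_le A hr)) hq
      with h | h
    · have := hto.voted2 b (h.mono (E.inbox_mono q hDt')) (hb.view.trans hcw.symm)
      exact hv2 (hcw ▸ this)
    · exact hto.blocks b (h.mono (E.inbox_mono q hDt')) (hb.view.trans hcw.symm)

namespace Spread

variable {w D : ℕ} {b : Block Hash}

/-- If no correct processor times out, then all of them vote in stage 2. -/
theorem vote2 (A : E.Standing δ) (h : E.Spread δ w b D)
    (hnn : ∀ r ∈ E.correct, ∀ s, E.start r ≤ s → w ∉ (E.st r s).nullified)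
    {r : Fin P.n} (hr : r ∈ E.correct) (q : Fin P.n) :
    ∃ s ≤ D + δ, (q, .vote2 b r) ∈ E.sent r s := by
  have hst := h.start_le A hr
  have hst' : E.start r ≤ D + δ := by omega
  have hnr := hnn r hr (D + δ) hst'
  have hv : w ∈ (E.st r (D + δ)).voted2 := by
    rcases ((h.reached r hr).trans
      (A.hE.grows A.hΔ hr hst (Nat.le_add_right D δ)).view).eq_or_lt with hw | hw
    · have hs := A.hE.settled hr hst'
      rcases h.blocksStar_or_blocks A (fun r hr => hnn r hr D (h.start_le A hr)) hr with hb | hb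
      · have := hs.star b (hb.mono (Ctx.inbox_subset_S _ _)) (h.view.trans hw)
        rw [← hw] at this
        exact this.resolve_right hnr
      · exact absurd (h.view.trans hw) (hs.blocks b (hb.mono (Ctx.inbox_subset_S _ _)))
    -- Leaving a view through a block entails a stage-2 vote unless the view was nullified.
    · rcases A.left hr hst' (h.one_le A) hw with ⟨_, _, h2⟩ | hc
      · exact h2.resolve_right hnr
      · obtain ⟨i, hi, hi', hi''⟩ := A.nullified_of_ncert hc
        exact absurd hi'' (hnn i hi _ hi')
  obtain ⟨b', h1, h2⟩ := (A.hE.inSlot_st A.hΔ hr hst').voted2 A.hE A.hΔ hr hv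
  simp only [A.hE.mem_outbox_st hr hst'] at h2
  obtain rfl : b' = b := by
    obtain ⟨s, _, hs⟩ := h2 r
    exact h.eq_of_blockProposed A (A.genuine_sent hs) h1
  exact h2 q

theorem isBlock (A : E.Standing δ) (h : E.Spread δ w b D) : P.IsBlock b := by
  obtain ⟨p, hp, hl, hbp⟩ := h.leader
  exact ((A.hE.inSlot_st A.hΔ hp (h.start_le A hp)).proposed A.hE A.hΔ hp hbp).1

/-- The stage-2 votes of the correct processors form the stage-2 certificate. As n-f ≥ f+1, they
form an M-certificate too, so `b` enters `blocks` and a settled processor cannot remain in view `w`.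
-/
theorem finalised (A : E.Standing δ) (h : E.Spread δ w b D)
    (hnn : ∀ r ∈ E.correct, ∀ s, E.start r ≤ s → w ∉ (E.st r s).nullified)
    {q : Fin P.n} (hq : q ∈ E.correct) :
    P.Certs (E.received q (D + 2 * δ)) (.cert b) ∧ w < (E.st q (D + 2 * δ)).view := by
  have hst := h.start_le A hq
  have hst' : E.start q ≤ D + 2 * δ := by omega
  have hD := h.le
  have hn := A.hn
  have hcard := A.le_ncard (S := E.received q (D + 2 * δ)) (g := Msg.vote2 b) fun r hr => by
    obtain ⟨s, hs, hs'⟩ := h.vote2 A hnn hr q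
    exact E.inbox_subset_received _ _ (A.mem_inbox hs' (by omega))
  refine ⟨.form b (by omega), ?_⟩
  have hle := (h.reached q hq).trans
    (A.hE.grows A.hΔ hq hst (Nat.le_add_right D (2 * δ))).view
  obtain ⟨c₀, π₀, _, _, _, _, b', hb', hpar, _⟩ := h.votable q
  have hb : P.Blocks (E.received q (D + 2 * δ)) b :=
    .step b b' (h.isBlock A) (.formM b (by omega))
      (hb'.mono ((E.inbox_mono q (Nat.le_add_right _ _)).trans (E.inbox_subset_received _ _))) hpar
  have hne := (A.hE.settled hq hst').blocks b
  rw [A.hE.S_st hq hst'] at hne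
  have := hne hb
  rw [h.view] at this
  omega

end Spread

/-! ### Initial views -/

/-- If a correct processor has proposed a block in a superview, then it has done so for the first
view. -/
theorem Standing.exists_proposed_firstView (A : E.Standing δ) {p : Fin P.n} (hp : p ∈ E.correct)
    {t : ℕ} (ht : E.start p ≤ t) {b : Block Hash} (hb : b ∈ (E.st p t).proposed) :
    ∃ b' ∈ (E.st p t).proposed, b'.view = P.firstView b.view := by
  have hs := A.hE.inSlot_st A.hΔ hp ht
  induction hv : b.view using Nat.strong_induction_on generalizing b with
  | _ v ih =>
    rcases hs.proposed_parent A.hE A.hΔ hp hb with ⟨hi, _⟩ | ⟨hi, b', hb', _, hv'⟩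
    · refine ⟨b, hb, ?_⟩
      rw [hv] at hi
      rw [hv, (P.initial_iff (hv ▸ (hs.proposed A.hE A.hΔ hp hb).1.1)).1 hi]
    · obtain ⟨b'', h1, h2⟩ := ih b'.view (by omega) hb' rfl
      refine ⟨b'', h1, h2.trans (P.firstView_eq_of_superview_eq ?_)⟩
      rw [← hv, ← hv']
      exact P.superview_succ (hs.proposed A.hE A.hΔ hp hb').1.1 (hv' ▸ hi)

/-- The leader's fragments of a proposed block arrive. -/
theorem Standing.frag_of_proposed (A : E.Standing δ) {p : Fin P.n} (hp : p ∈ E.correct) {t D : ℕ}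
    (ht : E.start p ≤ t) {b : Block Hash} (hb : b ∈ (E.st p t).proposed)
    (hD : max E.GST t + δ ≤ D) (j : Fin P.n) :
    ∃ c π, (p, .frag b j c π) ∈ (E.ctx j D).inbox ∧ P.CertFrag b.tag j c π := by
  obtain ⟨hblk, _, _, C, hC, hf⟩ := (A.hE.inSlot_st A.hΔ hp ht).proposed A.hE A.hΔ hp hb
  have hk := hblk.k_pos A.hn A.hn2
  have hkn := hblk.2.2.1
  obtain ⟨s, hs, hs'⟩ := (A.hE.mem_outbox_st hp ht).1 (hf j)
  have := P.certFrag_enc A.htree C b.tag.k hk (by omega) j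
  rw [← hC] at this
  exact ⟨_, _, A.mem_inbox hs' (by omega), this⟩

/-- One `δ` lets the leader catch up, a second one delivers its fragments. If the leader is already
past `w` at `t + δ`, it left through a view `w` block, which it must have proposed itself. -/
theorem Standing.spread_initial (A : E.Standing δ) {p r : Fin P.n} (hp : p ∈ E.correct)
    (hr : r ∈ E.correct) {w t : ℕ} (hw : 1 ≤ w) (hi : P.Initial w) (hl : P.IsLead p w)
    (hrt : E.start r ≤ t) (hrw : w ≤ (E.st r t).view) (ht : E.GST ≤ t)
    (hnn : ∀ q ∈ E.correct, ∀ s < t + 2 * δ, E.start q ≤ s → w ∉ (E.st q s).nullified) :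
    ∃ b, E.Spread δ w b (t + 2 * δ) := by
  have hδ0 := A.hδ0
  have hps := A.hE.start_le p hp
  have hpt : E.start p ≤ t + δ := by omega
  have hst := A.hE.inSlot_st A.hΔ hp hpt
  obtain ⟨b, hb, hbv⟩ : ∃ b ∈ (E.st p (t + δ)).proposed, b.view = w := by
    rcases (A.catch_up hr hp hrt hrw (D := t + δ) (by omega)).eq_or_lt with hv | hv
    -- A settled leader in its initial view has proposed something in this superview; following
    -- parents back leads to a proposal for the first view.
    · have hf := (A.hE.settled hp hpt).fresh
      simp only [Params.FreshSuperview, ← hv, hi, true_and, not_forall, not_not] at hf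
      obtain ⟨b, hb, hbs⟩ := hf hl
      obtain ⟨b', hb', hv'⟩ := A.exists_proposed_firstView hp hpt hb
      refine ⟨b', hb', hv'.trans ?_⟩
      rw [P.firstView_eq_of_superview_eq hbs, (P.initial_iff hw).1 hi]
    · rcases A.left hp hpt hw hv with ⟨_, ⟨b, h1, h2⟩, _⟩ | hc
      · obtain ⟨h3, h4⟩ := A.blockProposed h1 (by omega) p hp (h2 ▸ hl)
        exact ⟨b, h4, h2⟩
      · obtain ⟨i, hi1, hi2, hi3⟩ := A.nullified_of_ncert hc
        exact absurd hi3 (hnn i hi1 _ (by omega) hi2)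
  obtain ⟨hblk, _, hk, _⟩ := hst.proposed A.hE A.hΔ hp hb
  have hk := hk (hbv ▸ hi)
  obtain ⟨_, b', hpar, hb', hbv', hnc⟩ := (hst.proposed_parent A.hE A.hΔ hp hb).resolve_right
    fun h => h.1 (hbv ▸ hi)
  rw [A.hE.S_st hp hpt] at hb' hnc
  rw [hbv] at hbv' hnc
  refine ⟨b, by omega, ⟨p, hp, hl, (A.hE.grows A.hΔ hp hpt (by omega)).proposed hb⟩, hbv,
    fun q hq => A.catch_up hr hq hrt hrw (by omega), fun j => ?_, fun hf => ?_⟩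
  · obtain ⟨c, π, h1, h2⟩ := A.frag_of_proposed hp hpt hb (D := t + 2 * δ) (by omega) j
    exact ⟨c, π, ⟨p, h1⟩, hblk, hbv, h2, b', A.blocks_transfer hp hb' (by omega) j, hpar, hbv',
      fun u hu hu' => A.certs_transfer hp (hnc u hu hu') (by omega) j⟩
  · have hcard := A.card_correct
    have he := Finset.card_erase_of_mem hp
    -- The leader does not disseminate its own fragment when voting. The other correct processors
    -- number at least n-f-1, which is `k` in an initial view.
    obtain ⟨I, hI, hI'⟩ := Finset.exists_subset_card_eq
      (by omega : b.tag.k ≤ (E.correct.erase p).card)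
    refine ⟨I, hI', fun q hq j hj => ?_⟩
    obtain ⟨hjp, hj⟩ := Finset.mem_erase.1 (hI hj)
    obtain ⟨c, π, h1, h2⟩ := hf j hj fun hc => hjp (hc.unique hl)
    obtain ⟨s, hs, hs'⟩ := h2 q
    exact ⟨c, π, A.mem_inbox hs' (by omega), h1⟩

/-! ### Later views -/

theorem Standing.frag_of_disseminates (A : E.Standing δ) {j q : Fin P.n} (hq : q ∈ E.correct)
    {b : Block Hash} {D : ℕ} (hD : E.GST ≤ D) (h : E.DisseminatesFragment j b)
    (hr : P.Reached (E.received j D) b.view)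
    (hv : ∃ c π, P.Votable (E.received j D) j b.view b c π) :
    ∃ c π, (j, .frag b j c π) ∈ (E.ctx q (D + δ)).inbox ∧ P.CertFrag b.tag j c π := by
  obtain ⟨c, π, s, h1, h2, h3⟩ := h
  have hs := h3 D hr hv
  refine ⟨c, π, ?_, h1⟩
  -- `DisseminatesFragment` speaks only of other recipients. A correct processor that sends its
  -- fragment to another one, which exists as n ≥ 2, has sent it to itself too.
  by_cases hqj : q = j
  · subst hqj
    have : Nontrivial (Fin P.n) := Fin.nontrivial_iff_two_le.2 A.hn2
    obtain ⟨r, hr⟩ := exists_ne q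
    have hm := h2 r hr
    have hst := A.le_start_of_sent hq hm
    rw [A.hE.sent_eq q hq s hst] at hm
    have := (A.hE.inSlot_st A.hΔ hq hst).frag_self A.hE A.hΔ hq hr hm
    rw [← A.hE.sent_eq q hq s hst] at this
    exact A.mem_inbox this (by omega)
  · exact A.mem_inbox (h2 q hqj) (by omega)

/-- The first processor to arrive came through a view `w` block, since nobody nullified `w`. The
leader therefore proposed the next block before `t`, and a single `δ` delivers both its fragments
and the certificates that the first arrival forwards. -/
theorem Standing.spread_succ (A : E.Standing δ) {p r : Fin P.n} (hp : p ∈ E.correct)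
    (hr : r ∈ E.correct) {w t : ℕ} (hw : 1 ≤ w) (hi : ¬ P.Initial (w + 1)) (hl : P.IsLead p w)
    (hrt : E.Enters r (w + 1) t) (ht : E.GST ≤ t) (hwell : E.WellDisseminated (w + 1))
    (hnn : ∀ q ∈ E.correct, ∀ s, E.start q ≤ s → w ∉ (E.st q s).nullified) :
    ∃ b, E.Spread δ (w + 1) b (t + δ) := by
  have hδ0 := A.hδ0
  have hl' := hl.congr (P.superview_succ hw hi)
  obtain ⟨hvia, ⟨b', hb', hbv'⟩, _⟩ := (A.left hr hrt.1 hw hrt.2.1).resolve_right fun hc => by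
    obtain ⟨i, hi1, hi2, hi3⟩ := A.nullified_of_ncert hc
    exact hnn i hi1 _ hi2 hi3
  obtain ⟨t', ht', b, hbp, hbv⟩ := A.hE.ready_spec w hw hi p hp hl r hr t hrt hvia
  have hst := A.hE.inSlot_st A.hΔ hp hbp.1
  have hblk := (hst.proposed A.hE A.hΔ hp hbp.2.1).1
  obtain ⟨_, b'', hb'', hpar, hbv''⟩ := (hst.proposed_parent A.hE A.hΔ hp hbp.2.1).resolve_left
    fun h => hi (hbv ▸ h.1)
  -- The block through which view `w` was left and the parent of the new proposal are both view `w`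
  -- blocks of the correct leader, hence equal.
  obtain rfl : b' = b'' := A.eq_of_blockProposed hp
    (by rwa [show b''.view = w by omega]) hbp.1 hb'' (A.blockProposed hb') (by omega)
  -- No view lies strictly between that of the parent and `w + 1`, so no N-certificates are
  -- required.
  have hvot : ∀ j, ∃ c π, P.Votable (E.ctx j (t + δ)).inbox j (w + 1) b c π := fun j => by
    obtain ⟨c, π, h1, h2⟩ := A.frag_of_proposed hp hbp.1 hbp.2.1 (D := t + δ) (by omega) j
    exact ⟨c, π, ⟨p, h1⟩, hblk, hbv, h2, b', A.blocks_transfer hr hb' (by omega) j, hpar, by omega,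
      fun u hu hu' => by omega⟩
  refine ⟨b, by omega, ⟨p, hp, hl', (A.hE.grows A.hΔ hp hbp.1 (by omega)).proposed hbp.2.1⟩, hbv,
    fun q hq => A.catch_up hr hq hrt.1 hrt.2.1 (by omega), hvot, fun _ => ?_⟩
  have hk := hwell p hp hl' b t' hbp hbv
  rw [Set.ncard_eq_toFinset_card _ (Set.toFinite _)] at hk
  obtain ⟨I, hI, hI'⟩ := Finset.exists_subset_card_eq hk
  refine ⟨I, hI', fun q hq j hj => ?_⟩
  obtain ⟨c, π, hv⟩ := hvot j
  have hsub := E.inbox_subset_received j (t + δ)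
  have hdis : j ∈ {j | E.DisseminatesFragment j b} := (Set.Finite.mem_toFinset _).1 (hI hj)
  refine A.frag_of_disseminates hq (by omega) hdis ?_ ⟨c, π, ?_⟩
  · rw [hbv]
    exact (A.reached_transfer hr hrt.1 hrt.2.1 (by omega) j).mono hsub
  · rw [hbv]
    exact hv.mono hsub

/-! ### Superviews with a correct leader -/

/-- A processor which has reached view `w` has entered it. -/
theorem exists_enters {q : Fin P.n} {w s : ℕ} (hs : E.start q ≤ s) (hw : w ≤ (E.st q s).view) :
    ∃ t ≤ s, E.Enters q w t := by
  classical
  have hex : ∃ s, E.start q ≤ s ∧ w ≤ (E.st q s).view := ⟨s, hs, hw⟩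
  obtain ⟨h1, h2⟩ := Nat.find_spec hex
  refine ⟨Nat.find hex, Nat.find_min' hex ⟨hs, hw⟩, h1, h2, fun t ht ht' => ?_⟩
  by_contra hc
  exact Nat.find_min hex ht' ⟨ht, by omega⟩

/-- There is a first correct processor to enter a view which some correct processor reaches. -/
theorem exists_first_enters {q : Fin P.n} (hq : q ∈ E.correct) {w s : ℕ} (hs : E.start q ≤ s)
    (hw : w ≤ (E.st q s).view) :
    ∃ r ∈ E.correct, ∃ t, E.Enters r w t ∧
      ∀ q ∈ E.correct, ∀ s, E.start q ≤ s → w ≤ (E.st q s).view → t ≤ s := by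
  classical
  have hex : ∃ t, ∃ r ∈ E.correct, E.Enters r w t := by
    obtain ⟨t, _, ht⟩ := exists_enters hs hw
    exact ⟨t, q, hq, ht⟩
  obtain ⟨r, hr, h⟩ := Nat.find_spec hex
  refine ⟨r, hr, Nat.find hex, h, fun q hq s hs hw => ?_⟩
  obtain ⟨t, hts, ht⟩ := exists_enters hs hw
  exact (Nat.find_min' hex ⟨q, hq, ht⟩).trans hts

/-- The induction through the superview. Earlier views enter twice: time-outs there would nullify
`w` as well, and an N-certificate for the preceding view would allow entry without a proposal being
ready. -/
theorem Standing.not_nullified_of_first (A : E.Standing δ) {v : ℕ} {p : Fin P.n}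
    (hp : p ∈ E.correct) (hl : P.IsLead p v)
    (hGST : ∀ q ∈ E.correct, ∀ t₀, E.Enters q (P.firstView v) t₀ → E.GST ≤ t₀)
    (hwell : ∀ u, P.firstView v < u → u ≤ v → E.WellDisseminated u)
    {q₀ : Fin P.n} (hq₀ : q₀ ∈ E.correct) {s₀ : ℕ} (hs₀ : E.start q₀ ≤ s₀)
    (hv₀ : v ≤ (E.st q₀ s₀).view) (w : ℕ) (hvw : P.firstView v ≤ w) (hwv : w ≤ v) :
    ∀ q ∈ E.correct, ∀ s, E.start q ≤ s → w ∉ (E.st q s).nullified := by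
  induction w using Nat.strong_induction_on with
  | _ w ih =>
    have hpos := P.firstView_pos v
    have hδΔ := A.hδΔ
    have hsup := P.superview_eq_of_mem hvw hwv
    have hlw := hl.congr hsup.symm
    obtain ⟨r, hr, t, hrt, hfirst⟩ := exists_first_enters hq₀ hs₀ (hwv.trans hv₀)
    have ht : E.GST ≤ t := by
      -- The processor entered the first view of the superview no later than `w`, and that was at or
      -- after GST.
      obtain ⟨t₀, h1, h2⟩ := exists_enters hrt.1 (hvw.trans hrt.2.1)
      exact (hGST r hr t₀ h2).trans h1
    have hprev : ∀ u, P.firstView w ≤ u → u < w → ∀ q ∈ E.correct, ∀ s, E.start q ≤ s →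
        u ∉ (E.st q s).nullified := by
      rw [P.firstView_eq_of_superview_eq hsup]
      exact fun u h1 h2 => ih u h2 h1 (by omega)
    intro q hq s hs
    rcases hvw.eq_or_lt with heq | hlt
    · have hi : P.Initial w := heq ▸ P.initial_firstView v
      exact A.not_nullified hprev hfirst (D := t + 2 * δ) (.inl ⟨hi, by omega⟩)
        (A.spread_initial hp hr (by omega) hi hlw hrt.1 hrt.2.1 ht) hq hs
    · obtain ⟨w, rfl⟩ : ∃ w', w = w' + 1 := ⟨w - 1, by omega⟩
      have hi := P.not_initial_of_mem hlt hwv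
      exact A.not_nullified hprev hfirst (D := t + δ) (.inr ⟨hi, by omega⟩)
        (fun _ => A.spread_succ hp hr (by omega) hi
          (hlw.congr (P.superview_succ (by omega) hi).symm) hrt ht (hwell _ hlt hwv)
          (ih w (by omega) (by omega) (by omega))) hq hs

end Run

end Carnot

/-! ### The main theorem -/

open Carnot in
theorem mainTheorem4 {Hash : Type*} (P : Params Hash)
    (hn : 4 * P.f + 1 ≤ P.n) (hn2 : 2 ≤ P.n) (hx : 2 ≤ P.x) (hΔ : 0 < P.Δ)
    (hH : Function.Injective P.H) (htree : P.tree.size = P.n)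
    (E : Run P) (hE : E.IsExecution)
    (δ : ℕ) (hδ0 : 0 < δ) (hδ : E.DelayBound δ)
    (v : ℕ) (hv : 1 ≤ v) (hvi : ¬ P.Initial v)
    (p : Fin P.n) (hp : p ∈ E.correct) (hlead : P.IsLead p v)
    (hGST : ∀ q ∈ E.correct, ∀ t₀, E.Enters q (P.firstView v) t₀ → E.GST ≤ t₀)
    (t : ℕ) (ht : IsLeast {t | ∃ q ∈ E.correct, E.Enters q v t} t)
    (hwell : ∀ u, P.firstView v < u → u ≤ v → E.WellDisseminated u) :
    (∃ b : Block Hash, P.IsBlock b ∧ b.view = v ∧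
      ∀ q ∈ E.correct, P.Certs (E.received q (t + 3 * δ)) (.cert b)) ∧
    (∀ q ∈ E.correct, ∃ t' ≤ t + 3 * δ, E.Enters q (v + 1) t') ∧
    (∀ q ∈ E.correct, ∀ s r, (r, .nullify v q) ∉ E.sent q s) := by
  -- The given `δ` may exceed `Δ`, while the time-out estimates need a bound of at most `Δ`. The
  -- minimum of the two is again a delay bound, and finishing earlier does no harm.
  have A : E.Standing (min δ P.Δ) := by
    refine ⟨hn, hn2, hΔ, hH, htree, hE, lt_min hδ0 hΔ, fun q p s m h1 h2 => ?_, min_le_right _ _⟩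
    have := hδ q p s m h1 h2
    have := hE.arr_le q p s m h1 h2
    omega
  obtain ⟨⟨r, hr, hrt⟩, -⟩ := ht
  have hnn := A.not_nullified_of_first hp hlead hGST hwell hr hrt.1 hrt.2.1
  have hfv := P.firstView_le hv
  have hlt : P.firstView v < v := lt_of_le_of_ne hfv fun h => hvi ((P.initial_iff hv).2 h)
  have hpos := P.firstView_pos v
  obtain ⟨w, rfl⟩ : ∃ w, v = w + 1 := ⟨v - 1, by omega⟩
  have htG : E.GST ≤ t := by
    obtain ⟨t₀, h1, h2⟩ := Run.exists_enters hrt.1 (hfv.trans hrt.2.1)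
    exact (hGST r hr t₀ h2).trans h1
  obtain ⟨b, hb⟩ := A.spread_succ hp hr (by omega) hvi
    (hlead.congr (P.superview_succ (by omega) hvi).symm) hrt htG (hwell _ hlt le_rfl)
    (hnn w (by omega) (by omega))
  have hnv := hnn (w + 1) hfv le_rfl
  -- View `v` is not initial, so fragments are spread one delay after `t`; two more are needed for
  -- finalisation.
  have hle : t + min δ P.Δ + 2 * min δ P.Δ ≤ t + 3 * δ := by omega
  refine ⟨⟨b, hb.isBlock A, hb.view, fun q hq =>
    (hb.finalised A hnv hq).1.mono (E.received_mono q hle)⟩, fun q hq => ?_, fun q hq s r h => ?_⟩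
  · have hs := hE.start_le q hq
    obtain ⟨t', h1, h2⟩ := Run.exists_enters (by omega) (hb.finalised A hnv hq).2
    exact ⟨t', h1.trans hle, h2⟩
  · obtain ⟨h1, h2⟩ := A.nullified_of_sent hq h
    exact hnv q hq s h1 h2
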